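/- For every $n$ let $\mathbf p=(p_{11},p_{10},p_{01},p_{00})$ be a probability vector depending on $n$, let $p_{1*}=p_{11}+p_{10}$, and let $(G_a,G_b)\sim ER(n;\mathbf p)$ be a pair of correlated Erdős–Rényi graphs on a common set $V$ of $n$ vertices: independently for every pair $e$ of distinct vertices, the pair of indicators $(\mathbf 1_{e\in E(G_a)},\mathbf 1_{e\in E(G_b)})$ equals $(1,1),(1,0),(0,1),(0,0)$ with probabilities $p_{11},p_{10},p_{01},p_{00}$ respectively. For a graph $G$ on $V$ let $\delta_{G,1}\ge\delta_{G,2}\ge\dots\ge\delta_{G,n}$ be its degrees in decreasing order. For $h\in[n]$ let $f_h(G)=(w_1,\dots,w_h)$ be a list of $h$ distinct vertices of $G$ in which $w_i$ has degree $\delta_{G,i}$ for all $i\in[h]$; where this does not determine the list, ties are broken arbitrarily. Suppose that, as $n\to\infty$, $p_{00}=1-o(1)$, that $h=h(n)\in[n]$ satisfies $\log n=o(h)$ and $h=o(n)$, and that $$\max\{(\log h)^2,\; n(p_{01}+p_{10})\log h\}=o\!\left(\frac{n\,p_{11}}{h^4\log n}\cdot\frac{p_{11}}{p_{1*}}\right).$$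 Then, with probability $1-o(1)$, all of the following hold simultaneously: $f_h(G_a)=f_h(G_b)$; $\delta_{G_a,i}>\delta_{G_a,i+1}+2$ for all $i\in[h]$; and $\delta_{G_b,i}>\delta_{G_b,i+1}+2$ for all $i\in[h]$. -/

import Mathlib

open MeasureTheory Filter Topology Asymptotics

/-- Joint law `(p₁₁, p₁₀, p₀₁, p₀₀)` of the pair of indicators of one edge in the two graphs. -/
structure EdgeLaw where
  p11 : ℝ
  p10 : ℝ
  p01 : ℝ
  p00 : ℝ
  p11_nonneg : 0 ≤ p11
  p10_nonneg : 0 ≤ p10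
  p01_nonneg : 0 ≤ p01
  p00_nonneg : 0 ≤ p00
  sum_eq_one : p11 + p10 + p01 + p00 = 1

namespace EdgeLaw

/-- The marginal `p₁⁎ = p₁₁ + p₁₀`, the edge density of the first graph. -/
def p1s (p : EdgeLaw) : ℝ := p.p11 + p.p10

/-- The probability of each value of the pair (edge in the first graph, edge in the second). -/
def prob (p : EdgeLaw) : Bool × Bool → ℝ
  | (true, true) => p.p11
  | (true, false) => p.p10
  | (false, true) => p.p01
  | (false, false) => p.p00

lemma prob_nonneg (p : EdgeLaw) (b : Bool × Bool) : 0 ≤ p.prob b := by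
  rcases b with ⟨_ | _, _ | _⟩
  exacts [p.p00_nonneg, p.p01_nonneg, p.p10_nonneg, p.p11_nonneg]

lemma sum_prob (p : EdgeLaw) : ∑ b, p.prob b = 1 := by
  rw [Fintype.sum_prod_type]
  simp only [Fintype.sum_bool, prob]
  linarith [p.sum_eq_one]

/-- The law of the pair of edge indicators, as a probability mass function. -/
noncomputable def pmf (p : EdgeLaw) : PMF (Bool × Bool) :=
  PMF.ofFintype (fun b => ENNReal.ofReal (p.prob b)) (by
    rw [← ENNReal.ofReal_sum_of_nonneg fun b _ => p.prob_nonneg b, p.sum_prob,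
      ENNReal.ofReal_one])

end EdgeLaw

/-- The potential edges: unordered pairs of distinct vertices. -/
abbrev Pairs (V : Type*) : Type _ := {e : Sym2 V // ¬ e.IsDiag}

/-- The pair of graphs given by the edge indicators: `e` is an edge of the first graph iff
`(x e).1 = true`, and an edge of the second graph iff `(x e).2 = true`. -/
def graphPair {V : Type*} (x : Pairs V → Bool × Bool) : SimpleGraph V × SimpleGraph V :=
  (SimpleGraph.fromEdgeSet {e | ∃ he : ¬ e.IsDiag, (x ⟨e, he⟩).1 = true},
    SimpleGraph.fromEdgeSet {e | ∃ he : ¬ e.IsDiag, (x ⟨e, he⟩).2 = true})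

/-- The law `ER(n; p)` of a pair of correlated Erdős–Rényi graphs on `{0, …, n - 1}`: the pairs of
edge indicators are independent over the potential edges, each with law `p`. -/
noncomputable def correlatedER (n : ℕ) (p : EdgeLaw) :
    Measure (SimpleGraph (Fin n) × SimpleGraph (Fin n)) :=
  (Measure.pi fun _ : Pairs (Fin n) => p.pmf.toMeasure).map graphPair

instance correlatedER.instIsProbabilityMeasure (n : ℕ) (p : EdgeLaw) :
    IsProbabilityMeasure (correlatedER n p) :=
  Measure.isProbabilityMeasure_map (Measurable.of_discrete).aemeasurable

open Classical in
/-- The degrees of the vertices of `G`, listed in decreasing order. -/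
noncomputable def degreeList {n : ℕ} (G : SimpleGraph (Fin n)) : List ℕ :=
  (Finset.univ.val.map fun v => G.degree v).sort (· ≥ ·)

/-- The `i`-th largest degree `δ_{G,i}` of `G`, for `1 ≤ i ≤ n` (and `0` for `i > n`). -/
noncomputable def degSeq {n : ℕ} (G : SimpleGraph (Fin n)) (i : ℕ) : ℕ :=
  (degreeList G).getD (i - 1) 0

open Classical in
/-- `f` is a high-degree sorting function: `f G` lists `h` distinct vertices of `G`, the `i`-th of
which has the `i`-th largest degree (`Fin h` starts at `0`). Ties are broken arbitrarily. -/
def IsHighDegreeSorting {n h : ℕ} (f : SimpleGraph (Fin n) → (Fin h → Fin n)) : Prop :=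
  ∀ G : SimpleGraph (Fin n), Function.Injective (f G) ∧
    ∀ i : Fin h, G.degree (f G i) = degSeq G (i + 1)

/-- Each of the `h` largest degrees exceeds the next largest degree by more than `2`. -/
def DegreeSeparated {n : ℕ} (h : ℕ) (G : SimpleGraph (Fin n)) : Prop :=
  ∀ i ∈ Set.Icc 1 h, degSeq G i > degSeq G (i + 1) + 2

/-!
Both graphs contain the graph `H` of their common edges. Let `d v` be the degree of `v` in `H`, and
let `A v` be the number of edges at `v` that one of the two graphs has in addition. It is enough
that, with high probability, the `h` vertices of largest `d` are also, in the same order and with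
gaps above `2`, the `h` vertices of largest `d + A`: this applies to both graphs, and so both have
the same list of vertices of highest degree, namely that of `H`.

Given `d v`, the number `A v` is binomial with mean `r (n - 1 - d v)`, where `r` is small. This mean
decreases in `d v` with slope at least `-1/2`, so a gap in `d` survives when the fluctuations of `A`
around their means are smaller than the gap (`add_two_lt_of_gaps`). With
`M = max ((log h)², n (p₀₁ + p₁₀) log h)`, fluctuations of order `√M` are rare enough for a union
bound over the `O(h)` vertices with `d v` near the top, and fluctuations of order `√M log n` are
rare enough for a union bound over all vertices (`measureReal_exists_deviation_le`). The larger
fluctuations do no harm: `K`, of order `√M log n`, is the distance below the threshold `T` at which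
a vertex is too far down to matter.

The gaps in `d` come from a first moment computation. Let `T` be such that a binomial variable with
parameters `n - 2` and `p₁₁` is at least `T` with probability about `2 h / n`. At moderate distance
from its mean, the hazard rate `P(X = k) / P(X ≥ k)` of the binomial law is at most
`η = O(√(log n / (n p₁₁)))`, because consecutive masses have a ratio of at least `1 - O(η)`
(`exists_level_hazard_le`). Hence the tail at `T - K` is still `O(h / n)`, and masses above `T - K`
are `O(η h / n)` (`exists_threshold`). Two degrees become independent after the edge between the two
vertices is deleted, which changes both degrees by the same amount, so the expected number of pairs
above `T - K` whose degrees differ by at most `S` is `O(h² S η)` (`measureReal_exists_close_le`).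
For `S` of order `√M`, this tends to zero by hypothesis. A second moment computation shows that at
least `h` vertices have `d v ≥ T` (`measureReal_card_lt_le`).
-/

/-! ### Binomial tails and hazard rates -/

/-- The mass that the binomial law with `m` trials and success probability `p` gives to `k`. -/
noncomputable def binomMass (m : ℕ) (p : ℝ) (k : ℕ) : ℝ :=
  m.choose k * p ^ k * (1 - p) ^ (m - k)

/-- The mass that the binomial law with `m` trials and success probability `p` gives to `[k, ∞)`. -/
noncomputable def binomTail (m : ℕ) (p : ℝ) (k : ℕ) : ℝ :=
  ∑ j ∈ Finset.Icc k m, binomMass m p j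

section Binomial

variable {m : ℕ} {p : ℝ}

lemma binomMass_nonneg (hp0 : 0 ≤ p) (hp1 : p ≤ 1) (k : ℕ) : 0 ≤ binomMass m p k := by
  have : 0 ≤ 1 - p := by linarith
  unfold binomMass
  positivity

lemma binomMass_eq_zero {k : ℕ} (hk : m < k) : binomMass m p k = 0 := by
  simp [binomMass, Nat.choose_eq_zero_of_lt hk]

lemma binomTail_eq_zero {k : ℕ} (hk : m < k) : binomTail m p k = 0 := by
  simp [binomTail, Finset.Icc_eq_empty_of_lt hk]

lemma binomTail_nonneg (hp0 : 0 ≤ p) (hp1 : p ≤ 1) (k : ℕ) : 0 ≤ binomTail m p k :=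
  Finset.sum_nonneg fun _ _ => binomMass_nonneg hp0 hp1 _

lemma binomTail_eq_add (k : ℕ) :
    binomTail m p k = binomMass m p k + binomTail m p (k + 1) := by
  rcases le_or_gt k m with hk | hk
  · unfold binomTail
    rw [← Finset.insert_Icc_succ_left_eq_Icc hk, Finset.sum_insert (by simp)]
    rfl
  · rw [binomTail_eq_zero hk, binomTail_eq_zero (by omega), binomMass_eq_zero hk, add_zero]

lemma binomTail_antitone (hp0 : 0 ≤ p) (hp1 : p ≤ 1) : Antitone (binomTail m p) :=
  antitone_nat_of_succ_le fun k => by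
    rw [binomTail_eq_add k]
    linarith [binomMass_nonneg (m := m) hp0 hp1 k]

lemma binomMass_le_binomTail (hp0 : 0 ≤ p) (hp1 : p ≤ 1) (k : ℕ) :
    binomMass m p k ≤ binomTail m p k := by
  rw [binomTail_eq_add k]
  linarith [binomTail_nonneg (m := m) hp0 hp1 (k + 1)]

lemma sum_binomMass_mul_pow (z : ℝ) :
    ∑ j ∈ Finset.Icc 0 m, binomMass m p j * z ^ j = (p * z + (1 - p)) ^ m := by
  rw [add_pow, ← Nat.range_succ_eq_Icc_zero]
  refine Finset.sum_congr rfl fun j _ => ?_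
  rw [binomMass, mul_pow]
  ring

lemma binomTail_zero : binomTail m p 0 = 1 := by
  simpa [binomTail] using sum_binomMass_mul_pow (m := m) (p := p) 1

lemma binomTail_eq_sum_range_add (k i : ℕ) :
    binomTail m p k = ∑ j ∈ Finset.range i, binomMass m p (k + j) + binomTail m p (k + i) := by
  induction i with
  | zero => simp
  | succ i ih =>
    rw [ih, Finset.sum_range_succ, binomTail_eq_add (k + i)]
    simp only [add_assoc]

/-- Chernoff's bound for the upper tail of the binomial law. -/
lemma binomTail_le_exp (hp0 : 0 ≤ p) (hp1 : p ≤ 1) {ε : ℝ} (hε0 : 0 ≤ ε) (hε1 : ε ≤ 1 / 2)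
    {k : ℕ} (hk : m * p * (1 + ε) ≤ k) :
    binomTail m p k ≤ Real.exp (-(m * p * ε ^ 2 / 4)) := by
  have hμ : 0 ≤ m * p := by positivity
  have h1 : binomTail m p k * (1 + ε) ^ k ≤ Real.exp (m * p * ε) := by
    calc binomTail m p k * (1 + ε) ^ k
        ≤ ∑ j ∈ Finset.Icc k m, binomMass m p j * (1 + ε) ^ j := by
          rw [binomTail, Finset.sum_mul]
          refine Finset.sum_le_sum fun j hj => ?_
          have := (Finset.mem_Icc.1 hj).1
          have := binomMass_nonneg (m := m) hp0 hp1 j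
          gcongr
          linarith
      _ ≤ ∑ j ∈ Finset.Icc 0 m, binomMass m p j * (1 + ε) ^ j := by
          refine Finset.sum_le_sum_of_subset_of_nonneg
            (Finset.Icc_subset_Icc_left (Nat.zero_le _)) fun j _ _ => ?_
          have := binomMass_nonneg (m := m) hp0 hp1 j
          positivity
      _ = (p * ε + 1) ^ m := by rw [sum_binomMass_mul_pow]; ring
      _ ≤ Real.exp (p * ε) ^ m :=
          pow_le_pow_left₀ (by positivity) (Real.add_one_le_exp _) _
      _ = Real.exp (m * p * ε) := by rw [← Real.exp_nat_mul]; ring_nf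
  have hlog : ε - ε ^ 2 / 2 ≤ Real.log (1 + ε) := by
    have h := Real.le_log_one_add_of_nonneg hε0
    refine le_trans ?_ h
    rw [le_div_iff₀ (by linarith)]
    nlinarith [pow_nonneg hε0 3]
  have h2 : Real.exp (k * (ε - ε ^ 2 / 2)) ≤ (1 + ε) ^ k := by
    rw [← Real.exp_log (show 0 < (1 + ε) ^ k by positivity), Real.log_pow]
    gcongr
  have h3 : binomTail m p k * Real.exp (k * (ε - ε ^ 2 / 2)) ≤ Real.exp (m * p * ε) :=
    le_trans (mul_le_mul_of_nonneg_left h2 (binomTail_nonneg hp0 hp1 k)) h1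
  rw [← le_div_iff₀ (Real.exp_pos _), ← Real.exp_sub] at h3
  refine h3.trans (Real.exp_le_exp.2 ?_)
  have h4 : 0 ≤ ε - ε ^ 2 / 2 := by nlinarith
  nlinarith [mul_le_mul_of_nonneg_right hk h4, mul_nonneg hμ (sq_nonneg ε),
    mul_nonneg (mul_nonneg hμ (sq_nonneg ε)) (show 0 ≤ 1 / 2 - ε by linarith)]

lemma binomMass_succ_mul (j : ℕ) :
    binomMass m p (j + 1) * ((j + 1) * (1 - p)) = binomMass m p j * ((m - j) * p) := by
  rcases lt_trichotomy j m with hj | rfl | hj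
  · have h := Nat.choose_succ_right_eq m j
    have h' : (m.choose (j + 1) : ℝ) * (j + 1) = m.choose j * (m - j) := by
      rw [← Nat.cast_sub hj.le]; exact_mod_cast h
    have e : m - j = m - (j + 1) + 1 := by omega
    simp only [binomMass]
    rw [e, pow_succ, pow_succ]
    linear_combination p ^ j * p * (1 - p) ^ (m - (j + 1)) * (1 - p) * h'
  · simp [binomMass_eq_zero]
  · simp [binomMass_eq_zero hj, binomMass_eq_zero (hj.trans (Nat.lt_succ_self j))]

/-- A binomial law decreases slowly up to a moderate distance from its mean. -/
lemma mul_binomMass_le_binomMass_succ (hp0 : 0 ≤ p) (hp : p ≤ 1 / 2) {δ : ℝ} (hδ0 : 0 ≤ δ)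
    (hδ1 : δ ≤ 1) {j : ℕ} (hj : (j + 1 : ℝ) ≤ (m + 1) * p * (1 + δ / 2)) :
    (1 - δ) * binomMass m p j ≤ binomMass m p (j + 1) := by
  have hb := binomMass_nonneg (m := m) hp0 (by linarith) j
  have hpos : 0 < ((j : ℝ) + 1) * (1 - p) := by
    have : 0 < 1 - p := by linarith
    positivity
  refine le_of_mul_le_mul_right ?_ hpos
  rw [binomMass_succ_mul]
  have key : (1 - δ) * ((j + 1) * (1 - p)) ≤ (m - j) * p := by
    have h1 : ((j : ℝ) + 1) * (1 - δ / 2) ≤ (m + 1) * p := by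
      have h2 : ((j : ℝ) + 1) * (1 - δ / 2) ≤ (m + 1) * p * (1 + δ / 2) * (1 - δ / 2) :=
        mul_le_mul_of_nonneg_right hj (by linarith)
      have h3 : 0 ≤ ((m : ℝ) + 1) * p := by positivity
      nlinarith [mul_nonneg h3 (sq_nonneg δ)]
    have h4 : ((j : ℝ) + 1) * (1 - δ * (1 - p)) ≤ (j + 1) * (1 - δ / 2) := by
      refine mul_le_mul_of_nonneg_left ?_ (by positivity)
      nlinarith
    nlinarith
  nlinarith

/-- The hazard rate of a binomial law at `k`, a moderate distance above the mean, is at most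
`2 / (L + 1)`: the `L` masses that follow the one at `k` are at least half as large. -/
lemma mul_binomMass_le_binomTail (hp0 : 0 ≤ p) (hp : p ≤ 1 / 2) {δ : ℝ} (hδ0 : 0 ≤ δ)
    (hδ1 : δ ≤ 1) {k L : ℕ} (hL : L * δ ≤ 1 / 2)
    (hk : (k + L : ℝ) ≤ (m + 1) * p * (1 + δ / 2)) :
    (L + 1) / 2 * binomMass m p k ≤ binomTail m p k := by
  have hb := binomMass_nonneg (m := m) hp0 (by linarith) k
  have h1 : ∀ i ≤ L, (1 - δ) ^ i * binomMass m p k ≤ binomMass m p (k + i) := by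
    intro i
    induction i with
    | zero => simp
    | succ i ih =>
      intro hi
      have h2 := mul_binomMass_le_binomMass_succ (m := m) hp0 hp hδ0 hδ1 (j := k + i) (by
        have : ((i + 1 : ℕ) : ℝ) ≤ L := by exact_mod_cast hi
        push_cast at this ⊢
        linarith)
      calc (1 - δ) ^ (i + 1) * binomMass m p k
          = (1 - δ) * ((1 - δ) ^ i * binomMass m p k) := by ring
        _ ≤ (1 - δ) * binomMass m p (k + i) :=
            mul_le_mul_of_nonneg_left (ih (by omega)) (by linarith)
        _ ≤ _ := h2
  have h3 : ∀ i ∈ Finset.range (L + 1), 1 / 2 * binomMass m p k ≤ binomMass m p (k + i) := by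
    intro i hi
    have hi' : i ≤ L := Nat.lt_succ_iff.1 (Finset.mem_range.1 hi)
    refine le_trans (mul_le_mul_of_nonneg_right ?_ hb) (h1 i hi')
    have h4 := one_add_mul_le_pow (show (-2 : ℝ) ≤ -δ by linarith) i
    have h5 : (i : ℝ) * δ ≤ L * δ := by gcongr
    rw [sub_eq_add_neg]
    nlinarith
  have h6 := Finset.sum_le_sum h3
  rw [Finset.sum_const, Finset.card_range, nsmul_eq_mul] at h6
  rw [binomTail_eq_sum_range_add k (L + 1)]
  have := binomTail_nonneg (m := m) hp0 (by linarith) (k + (L + 1))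
  push_cast at h6
  linarith

/-- Below a level `k₀` whose tail probability is at most `exp (-m p δ² / 64)`, the hazard rate of
the binomial law is at most `4 δ`. -/
lemma exists_level_hazard_le (hp0 : 0 ≤ p) (hp : p ≤ 1 / 2) {δ : ℝ} (hδ0 : 0 < δ)
    (hδ1 : δ ≤ 1 / 2) (hδ : 4 ≤ m * p * δ ^ 2) :
    ∃ k₀ : ℕ, (∀ k ≤ k₀, binomMass m p k ≤ 4 * δ * binomTail m p k) ∧
      binomTail m p k₀ ≤ Real.exp (-(m * p * δ ^ 2 / 64)) := by
  set L := ⌊1 / (2 * δ)⌋₊ with hLdef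
  have hL1 : (L : ℝ) ≤ 1 / (2 * δ) := Nat.floor_le (by positivity)
  have hL2 : 1 / (2 * δ) < L + 1 := Nat.lt_floor_add_one _
  have hL1' : L * δ ≤ 1 / 2 := by
    rw [le_div_iff₀ (by positivity)] at hL1
    linarith
  have hL2' : 1 / 2 < (L + 1) * δ := by
    rw [div_lt_iff₀ (by positivity)] at hL2
    linarith
  have hμ : 0 ≤ m * p := by positivity
  have hroom : m * p * (1 + δ / 4) + L + 1 ≤ (m + 1) * p * (1 + δ / 2) := by
    have h1 : (L : ℝ) + 1 ≤ m * p * δ / 4 := by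
      refine le_of_mul_le_mul_right (a := δ) ?_ hδ0
      nlinarith
    nlinarith
  set J := ⌊((m : ℝ) + 1) * p * (1 + δ / 2)⌋₊ with hJdef
  have hJ1 : (J : ℝ) ≤ (m + 1) * p * (1 + δ / 2) := Nat.floor_le (by positivity)
  have hJ2 : ((m : ℝ) + 1) * p * (1 + δ / 2) < J + 1 := Nat.lt_floor_add_one _
  have hLJ : L ≤ J := by
    have : (L : ℝ) ≤ J := by nlinarith
    exact_mod_cast this
  refine ⟨J - L, fun k hk => ?_, ?_⟩
  · have hk' : (k : ℝ) + L ≤ J := by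
      have : k + L ≤ J := by omega
      exact_mod_cast this
    have h := mul_binomMass_le_binomTail (m := m) hp0 hp hδ0.le (by linarith) hL1'
      (hk'.trans hJ1)
    have hb := binomMass_nonneg (m := m) hp0 (by linarith) k
    nlinarith
  · have hk' : m * p * (1 + δ / 4) ≤ ((J - L : ℕ) : ℝ) := by
      rw [Nat.cast_sub hLJ]
      linarith
    refine (binomTail_le_exp hp0 (by linarith) (by positivity) (by linarith) hk').trans
      (Real.exp_le_exp.2 ?_)
    linarith

/-- A threshold `T` whose tail probability is about `2 x`, such that the tail grows by at most a
constant factor, and the masses are of order `x η` at most, down to `T - K`. -/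
lemma exists_threshold (hp0 : 0 ≤ p) (hp1 : p ≤ 1) {η x : ℝ} {k₀ K : ℕ} (hη0 : 0 ≤ η)
    (hη1 : η ≤ 1 / 2) (hx0 : 0 < x) (hx1 : 2 * x ≤ 1)
    (hhaz : ∀ k ≤ k₀, binomMass m p k ≤ η * binomTail m p k)
    (htail : binomTail m p k₀ ≤ x * η) (hK : K * η ≤ 1 / 2) :
    ∃ T : ℕ, 2 * x ≤ binomTail m p T ∧
      binomTail m p (T - 1) ≤ (1 + 2 * η) * binomTail m p T ∧
      binomTail m p (T - K) ≤ 8 * x ∧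
      ∀ k, T - K ≤ k → binomMass m p k ≤ 8 * x * η := by
  classical
  have hanti := binomTail_antitone (m := m) hp0 hp1
  have hex : ∃ k, binomTail m p (k + 1) < 2 * x :=
    ⟨m, by rw [binomTail_eq_zero (Nat.lt_succ_self m)]; linarith⟩
  set T := Nat.find hex with hT
  have hT1 : binomTail m p (T + 1) < 2 * x := Nat.find_spec hex
  have hT2 : 2 * x ≤ binomTail m p T := by
    rcases Nat.eq_zero_or_pos T with h0 | h0
    · rw [h0, binomTail_zero]; exact hx1
    · have := Nat.find_min hex (m := T - 1) (by omega)
      rw [Nat.sub_add_cancel h0] at this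
      exact not_lt.1 this
  have hTk : T ≤ k₀ := by
    by_contra! hlt
    have := hanti hlt.le
    nlinarith
  have hTx : binomTail m p T ≤ 4 * x := by
    have h1 := binomTail_eq_add (m := m) (p := p) T
    have h2 := hhaz T hTk
    nlinarith
  have hshift : ∀ i, binomTail m p (T - i) ≤ binomTail m p T + i * η * binomTail m p (T - i) := by
    intro i
    have hsum := binomTail_eq_sum_range_add (m := m) (p := p) (T - i) (T - (T - i))
    rw [show T - i + (T - (T - i)) = T by omega] at hsum
    have hle : ∑ j ∈ Finset.range (T - (T - i)), binomMass m p (T - i + j) ≤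
        ∑ j ∈ Finset.range (T - (T - i)), η * binomTail m p (T - i) := by
      refine Finset.sum_le_sum fun j hj => ?_
      have hj' := Finset.mem_range.1 hj
      exact (hhaz _ (by omega)).trans
        (mul_le_mul_of_nonneg_left (hanti (Nat.le_add_right _ _)) hη0)
    rw [Finset.sum_const, Finset.card_range, nsmul_eq_mul] at hle
    have hi : ((T - (T - i) : ℕ) : ℝ) ≤ i := by
      have : T - (T - i) ≤ i := by omega
      exact_mod_cast this
    have hB := binomTail_nonneg (m := m) hp0 hp1 (T - i)
    have := mul_le_mul_of_nonneg_right hi (mul_nonneg hη0 hB)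
    linarith
  have hTK : binomTail m p (T - K) ≤ 8 * x := by
    have h1 := hshift K
    have hB := binomTail_nonneg (m := m) hp0 hp1 (T - K)
    have := mul_le_mul_of_nonneg_right hK hB
    linarith
  refine ⟨T, hT2, ?_, hTK, fun k hk => ?_⟩
  · have h1 := hshift 1
    have hB := binomTail_nonneg (m := m) hp0 hp1 (T - 1)
    simp only [Nat.cast_one, one_mul] at h1
    have h2 : binomTail m p (T - 1) * (1 - η) ≤ binomTail m p T := by linarith
    have h3 := mul_le_mul_of_nonneg_left h2 (show 0 ≤ 1 + 2 * η by linarith)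
    nlinarith [mul_nonneg hB (mul_nonneg hη0 (show 0 ≤ 1 - 2 * η by linarith))]
  · rcases le_or_gt k k₀ with hk0 | hk0
    · have h1 := hhaz k hk0
      have h2 := mul_le_mul_of_nonneg_left ((hanti hk).trans hTK) hη0
      linarith
    · have h1 := binomMass_le_binomTail (m := m) hp0 hp1 k
      have h2 := hanti hk0.le
      nlinarith [mul_nonneg hx0.le hη0]

end Binomial

/-! ### Occupation numbers of independent configurations -/

/-- The number of indices in `S` at which the configuration `x` takes the value `c`. -/
def occ {ι α : Type*} [DecidableEq α] (c : α) (S : Finset ι) (x : ι → α) : ℕ :=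
  (S.filter fun e => x e = c).card

lemma occ_mono {ι α : Type*} [DecidableEq α] (c : α) {S T : Finset ι} (h : S ⊆ T) (x : ι → α) :
    occ c S x ≤ occ c T x :=
  Finset.card_le_card (Finset.filter_subset_filter _ h)

lemma occ_le_card {ι α : Type*} [DecidableEq α] (c : α) (S : Finset ι) (x : ι → α) :
    occ c S x ≤ S.card :=
  Finset.card_filter_le _ _

/-- Expansion of a weighted indicator of `occ c S x = k` over the possible sets `R` of indices
where `c` occurs; each summand is a product over the indices. -/
lemma ite_occ_eq_sum_prod {ι α : Type*} [DecidableEq α] [Fintype ι] [DecidableEq ι] {a c : α}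
    (hac : a ≠ c) (S : Finset ι) (k : ℕ) (z : ℝ) (x : ι → α) :
    (if occ c S x = k then z ^ occ a S x else 0) =
      ∑ R ∈ S.powersetCard k, ∏ e, (if e ∈ R then (if x e = c then 1 else 0)
        else if e ∈ S then (if x e = c then 0 else if x e = a then z else 1) else 1) := by
  have key : ∀ R ∈ S.powersetCard k,
      ∏ e, (if e ∈ R then (if x e = c then 1 else 0)
        else if e ∈ S then (if x e = c then 0 else if x e = a then z else 1) else 1) =
      if R = S.filter (fun e => x e = c) then z ^ occ a S x else 0 := by
    intro R hR
    have hRS := (Finset.mem_powersetCard.1 hR).1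
    split_ifs with h
    · have h1 : ∀ e, (if e ∈ R then (if x e = c then 1 else 0)
          else if e ∈ S then (if x e = c then 0 else if x e = a then z else 1) else 1) =
          if e ∈ S.filter (fun e => x e = a) then z else 1 := by
        intro e
        subst h
        simp only [Finset.mem_filter]
        by_cases h2 : e ∈ S <;> by_cases h3 : x e = c <;> simp [h2, h3, hac.symm]
      rw [Finset.prod_congr rfl fun e _ => h1 e, Finset.prod_ite_mem, Finset.univ_inter,
        Finset.prod_const, occ]
    · have : ∃ e, ¬(e ∈ R ↔ e ∈ S.filter (fun e => x e = c)) := by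
        by_contra! h'
        exact h (Finset.ext h')
      obtain ⟨e, he⟩ := this
      refine Finset.prod_eq_zero (Finset.mem_univ e) ?_
      by_cases h2 : e ∈ R
      · have h3 : x e ≠ c := fun h3 => he (by simp [h2, h3, hRS h2])
        simp [h2, h3]
      · have h3 : e ∈ S ∧ x e = c := by
          by_contra h3
          exact he (by simp only [h2, Finset.mem_filter, h3])
        simp [h2, h3.1, h3.2]
  rw [Finset.sum_congr rfl key, Finset.sum_ite_eq']
  simp only [Finset.mem_powersetCard, Finset.filter_subset, true_and, occ]
  congr!

lemma measureReal_eq_integral_ite {Ω : Type*} [Finite Ω] [MeasurableSpace Ω]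
    [MeasurableSingletonClass Ω] (μ : Measure Ω) (P : Ω → Prop) [DecidablePred P] :
    μ.real {x | P x} = ∫ x, (if P x then (1 : ℝ) else 0) ∂μ := by
  rw [← integral_indicator_one (Set.toFinite {x | P x}).measurableSet]
  refine integral_congr_ae (Eventually.of_forall fun x => ?_)
  simp [Set.indicator_apply]

/-- Chebyshev's inequality for the number of events of a finite family that occur. -/
lemma measureReal_card_lt_mul_le {Ω V : Type*} [Finite Ω] [MeasurableSpace Ω]
    [MeasurableSingletonClass Ω] (μ : Measure Ω) [IsProbabilityMeasure μ] [Fintype V]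
    (E : V → Set Ω)
    [∀ x, DecidablePred fun v => x ∈ E v] {a : ℝ} (ha : 0 ≤ a) :
    μ.real
        {x | ((Finset.univ.filter fun v => x ∈ E v).card : ℝ) < a / 2} * (a / 2) ^ 2 ≤
      ∑ u, ∑ v, μ.real (E u ∩ E v) -
        2 * a * ∑ v, μ.real (E v) + a ^ 2 := by
  classical
  have hint : ∀ (s : Set Ω) [DecidablePred fun x => x ∈ s],
      μ.real s = ∫ x, (if x ∈ s then (1 : ℝ) else 0) ∂μ :=
    fun s _ => measureReal_eq_integral_ite μ (fun x => x ∈ s)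
  have hcard : ∀ x, ((Finset.univ.filter fun v => x ∈ E v).card : ℝ) =
      ∑ v, if x ∈ E v then (1 : ℝ) else 0 := fun x => by simp
  have hsq : ∫ x, ((Finset.univ.filter fun v => x ∈ E v).card - a : ℝ) ^ 2 ∂μ =
      ∑ u, ∑ v, μ.real (E u ∩ E v) - 2 * a * ∑ v, μ.real (E v) + a ^ 2 := by
    have hexp : ∀ x, ((Finset.univ.filter fun v => x ∈ E v).card - a : ℝ) ^ 2 =
        ∑ u, ∑ v, (if x ∈ E u ∩ E v then (1 : ℝ) else 0) -
          2 * a * ∑ v, (if x ∈ E v then (1 : ℝ) else 0) + a ^ 2 := by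
      intro x
      have : ∀ u v, (if x ∈ E u ∩ E v then (1 : ℝ) else 0) =
          (if x ∈ E u then (1 : ℝ) else 0) * (if x ∈ E v then (1 : ℝ) else 0) := by
        intro u v
        by_cases h1 : x ∈ E u <;> by_cases h2 : x ∈ E v <;> simp [h1, h2]
      simp_rw [this, ← Finset.sum_mul_sum, hcard]
      ring
    simp_rw [hexp]
    rw [integral_add Integrable.of_finite Integrable.of_finite,
      integral_sub Integrable.of_finite Integrable.of_finite,
      integral_finsetSum _ fun _ _ => Integrable.of_finite, integral_const_mul,
      integral_finsetSum _ fun _ _ => Integrable.of_finite]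
    have h1 : ∀ u, ∫ x, ∑ v, (if x ∈ E u ∩ E v then (1 : ℝ) else 0) ∂μ =
        ∑ v, μ.real (E u ∩ E v) := fun u => by
      rw [integral_finsetSum _ fun _ _ => Integrable.of_finite]
      exact Finset.sum_congr rfl fun v _ => (hint _).symm
    have h2 : ∀ v, ∫ x, (if x ∈ E v then (1 : ℝ) else 0) ∂μ = μ.real (E v) :=
      fun v => (hint _).symm
    simp_rw [h1, h2]
    simp
  rw [← hsq, hint, ← integral_mul_const]
  refine integral_mono Integrable.of_finite Integrable.of_finite fun x => ?_
  simp only [Set.mem_ofPred_eq]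
  split_ifs with h
  · rw [one_mul, ← sub_sq_comm]
    exact pow_le_pow_left₀ (by positivity) (by linarith) 2
  · rw [zero_mul]; positivity

section Law

variable {ι α : Type*} [DecidableEq α] [Fintype ι] [Fintype α] [MeasurableSpace α]
  [MeasurableSingletonClass α] (ν : Measure α) [IsProbabilityMeasure ν]

lemma integral_ite_eq (c : α) (r : ℝ) :
    ∫ y, (if y = c then r else 0) ∂ν = ν.real {c} * r := by
  rw [integral_fintype (Integrable.of_finite)]
  simp

/-- The joint law of two occupation numbers, through a generating function in the second. -/
lemma integral_ite_occ {a c : α} (hac : a ≠ c) (S : Finset ι) (k : ℕ) (z : ℝ) :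
    ∫ x, (if occ c S x = k then z ^ occ a S x else 0) ∂(Measure.pi fun _ : ι => ν) =
      S.card.choose k * ν.real {c} ^ k *
        (1 - ν.real {c} + ν.real {a} * (z - 1)) ^ (S.card - k) := by
  classical
  have h1 : ∫ y, (if y = c then (0 : ℝ) else if y = a then z else 1) ∂ν =
      1 - ν.real {c} + ν.real {a} * (z - 1) := by
    have : ∀ y, (if y = c then (0 : ℝ) else if y = a then z else 1) =
        1 - (if y = c then 1 else 0) + (if y = a then z - 1 else 0) := by
      intro y
      by_cases h2 : y = c
      · subst h2; simp [hac.symm]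
      · by_cases h3 : y = a <;> simp [h2, h3]
        simp [hac]
    simp_rw [this]
    rw [integral_add Integrable.of_finite Integrable.of_finite,
      integral_sub Integrable.of_finite Integrable.of_finite, integral_ite_eq, integral_ite_eq]
    simp
  simp_rw [ite_occ_eq_sum_prod hac S k z]
  rw [integral_finsetSum _ fun _ _ => Integrable.of_finite]
  have h2 : ∀ R ∈ S.powersetCard k,
      ∫ x, ∏ e, (if e ∈ R then (if x e = c then 1 else 0)
        else if e ∈ S then (if x e = c then 0 else if x e = a then z else 1) else 1)
        ∂(Measure.pi fun _ : ι => ν) =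
      ν.real {c} ^ k * (1 - ν.real {c} + ν.real {a} * (z - 1)) ^ (S.card - k) := by
    intro R hR
    obtain ⟨hRS, hRk⟩ := Finset.mem_powersetCard.1 hR
    rw [integral_fintype_prod_eq_prod (μ := fun _ : ι => ν) fun (e : ι) (y : α) =>
      if e ∈ R then (if y = c then (1 : ℝ) else 0)
        else if e ∈ S then (if y = c then 0 else if y = a then z else 1) else 1]
    have h3 : ∀ e, ∫ y, (if e ∈ R then (if y = c then (1 : ℝ) else 0)
        else if e ∈ S then (if y = c then 0 else if y = a then z else 1) else 1) ∂ν =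
        (if e ∈ R then ν.real {c} else 1) *
          if e ∈ S \ R then 1 - ν.real {c} + ν.real {a} * (z - 1) else 1 := by
      intro e
      by_cases h4 : e ∈ R
      · simp [h4, integral_ite_eq]
      · by_cases h5 : e ∈ S
        · simp only [h4, h5, if_true, if_false, h1, Finset.mem_sdiff, not_false_eq_true,
            and_self, one_mul]
        · simp [h4, h5]
    rw [Finset.prod_congr rfl fun e _ => h3 e, Finset.prod_mul_distrib, Finset.prod_ite_mem,
      Finset.prod_ite_mem, Finset.univ_inter, Finset.univ_inter, Finset.prod_const,
      Finset.prod_const, Finset.card_sdiff_of_subset hRS, hRk]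
  rw [Finset.sum_congr rfl h2, Finset.sum_const, Finset.card_powersetCard, nsmul_eq_mul,
    mul_assoc]

/-- An occupation number has a binomial law. -/
lemma measureReal_occ_eq [Nontrivial α] (c : α) (S : Finset ι) (k : ℕ) :
    (Measure.pi fun _ : ι => ν).real {x | occ c S x = k} =
      binomMass S.card (ν.real {c}) k := by
  obtain ⟨a, hac⟩ := exists_ne c
  have h := integral_ite_occ ν hac S k 1
  rw [measureReal_eq_integral_ite]
  simpa [binomMass] using h

lemma measureReal_le_occ [Nontrivial α] (c : α) (S : Finset ι) (k : ℕ) :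
    (Measure.pi fun _ : ι => ν).real {x | k ≤ occ c S x} =
      binomTail S.card (ν.real {c}) k := by
  have h : {x : ι → α | k ≤ occ c S x} = ⋃ j ∈ Finset.Icc k S.card, {x | occ c S x = j} := by
    ext x
    simp [occ_le_card]
  rw [h, measureReal_biUnion_finset, binomTail]
  · exact Finset.sum_congr rfl fun j _ => measureReal_occ_eq ν c S j
  · intro i _ j _ hij
    refine Set.disjoint_left.2 fun x hx hx' => hij ?_
    exact (show occ c S x = i from hx).symm.trans hx'
  · exact fun j _ => (Set.toFinite _).measurableSet

/-- Events that concern disjoint sets of indices are independent. -/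
lemma measureReal_occ_inter {c : α} {S S' : Finset ι} (hS : Disjoint S S') (s s' : Set ℕ) :
    (Measure.pi fun _ : ι => ν).real {x | occ c S x ∈ s ∧ occ c S' x ∈ s'} =
      (Measure.pi fun _ : ι => ν).real {x | occ c S x ∈ s} *
        (Measure.pi fun _ : ι => ν).real {x | occ c S' x ∈ s'} := by
  classical
  have hind : ProbabilityTheory.iIndepFun (fun (i : ι) (x : ι → α) => x i)
      (Measure.pi fun _ : ι => ν) :=
    ProbabilityTheory.iIndepFun_pi (X := fun (_ : ι) (y : α) => y) fun i => aemeasurable_id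
  have hind2 := hind.indepFun_finset S S' hS fun i => measurable_pi_apply i
  have hcomp : ∀ U : Finset ι, ∀ x : ι → α,
      (Finset.univ.filter fun e : U => x e = c).card = occ c U x := by
    intro U x
    rw [occ, ← Finset.card_map (Function.Embedding.subtype _)]
    congr 1
    ext e
    simp [and_comm]
  have hind3 := hind2.comp (φ := fun y : S → α => (Finset.univ.filter fun e => y e = c).card)
    (ψ := fun y : S' → α => (Finset.univ.filter fun e => y e = c).card)
    (measurable_of_countable _) (measurable_of_countable _)
  have hind4 : ProbabilityTheory.IndepFun (occ c S) (occ c S')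
      (Measure.pi fun _ : ι => ν) := by
    convert hind3 using 1 <;> exact funext fun x => (hcomp _ x).symm
  have h := congrArg ENNReal.toReal
    (hind4.measure_inter_preimage_eq_mul s s' .of_discrete .of_discrete)
  rw [ENNReal.toReal_mul] at h
  exact h

/-- Exponential moments of `occ a S`, centred at its conditional mean given `occ c S`. -/
lemma integral_ite_occ_exp_le {a c : α} (hac : a ≠ c) (hc : ν.real {c} < 1) (S : Finset ι)
    (k : ℕ) {r l : ℝ} (hr : ν.real {a} = r * (1 - ν.real {c})) (hr1 : r ≤ 1) (hl : |l| ≤ 1) :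
    ∫ x, (if occ c S x = k then Real.exp (l * (occ a S x - r * (S.card - occ c S x))) else 0)
        ∂(Measure.pi fun _ : ι => ν) ≤
      binomMass S.card (ν.real {c}) k * Real.exp (S.card * r * l ^ 2) := by
  have hc0 : 0 ≤ ν.real {c} := measureReal_nonneg
  have hr0 : 0 ≤ r := by
    have h1 : 0 ≤ r * (1 - ν.real {c}) := hr ▸ measureReal_nonneg
    exact nonneg_of_mul_nonneg_left h1 (by linarith)
  rcases lt_or_ge S.card k with hk | hk
  · have h0 : ∀ x : ι → α, occ c S x ≠ k := fun x => ((occ_le_card c S x).trans_lt hk).ne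
    simp [h0, binomMass_eq_zero hk]
  have h1 : ∀ x : ι → α,
      (if occ c S x = k then Real.exp (l * (occ a S x - r * (S.card - occ c S x))) else 0) =
      Real.exp (-(l * r * (S.card - k))) *
        (if occ c S x = k then Real.exp l ^ occ a S x else 0) := by
    intro x
    split_ifs with h
    · rw [← Real.exp_nat_mul, ← Real.exp_add, h]
      congr 1
      ring
    · simp
  simp_rw [h1]
  rw [integral_const_mul, integral_ite_occ ν hac, hr,
    show 1 - ν.real {c} + r * (1 - ν.real {c}) * (Real.exp l - 1) =
      (1 + r * (Real.exp l - 1)) * (1 - ν.real {c}) by ring, mul_pow]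
  have hexp : |Real.exp l - 1 - l| ≤ l ^ 2 := Real.abs_exp_sub_one_sub_id_le hl
  have h2 : (1 + r * (Real.exp l - 1)) ^ (S.card - k) ≤
      Real.exp (r * (l + l ^ 2)) ^ (S.card - k) := by
    refine pow_le_pow_left₀ ?_ ?_ _
    · nlinarith [Real.exp_pos l]
    · have := Real.add_one_le_exp (r * (l + l ^ 2))
      have := mul_le_mul_of_nonneg_left (le_of_abs_le hexp) hr0
      linarith
  rw [← Real.exp_nat_mul, Nat.cast_sub hk] at h2
  have hb := binomMass_nonneg (m := S.card) hc0 hc.le k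
  calc Real.exp (-(l * r * (S.card - k))) * (S.card.choose k * ν.real {c} ^ k *
        ((1 + r * (Real.exp l - 1)) ^ (S.card - k) * (1 - ν.real {c}) ^ (S.card - k)))
      = binomMass S.card (ν.real {c}) k * (Real.exp (-(l * r * (S.card - k))) *
        (1 + r * (Real.exp l - 1)) ^ (S.card - k)) := by rw [binomMass]; ring
    _ ≤ binomMass S.card (ν.real {c}) k * (Real.exp (-(l * r * (S.card - k))) *
        Real.exp ((S.card - k) * (r * (l + l ^ 2)))) := by gcongr
    _ ≤ _ := by
        rw [← Real.exp_add]
        refine mul_le_mul_of_nonneg_left (Real.exp_le_exp.2 ?_) hb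
        have : 0 ≤ (k : ℝ) * r * l ^ 2 := by positivity
        nlinarith

/-- Bernstein-type bound for `occ a S` around its conditional mean given `occ c S`, on the event
that `occ c S` is at least `T`. -/
lemma measureReal_occ_deviation_le {a c : α} (hac : a ≠ c) (hc : ν.real {c} < 1) (S : Finset ι)
    (T : ℕ) {r t L : ℝ} (hr : ν.real {a} = r * (1 - ν.real {c})) (hr1 : r ≤ 1) (ht : 0 < t)
    (hL : 0 ≤ L) (htL : 2 * L ≤ t) (htL2 : 4 * (S.card * r) * L ≤ t ^ 2) :
    (Measure.pi fun _ : ι => ν).real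
        {x | T ≤ occ c S x ∧ t < |(occ a S x : ℝ) - r * (S.card - occ c S x)|} ≤
      2 * Real.exp (-L) * binomTail S.card (ν.real {c}) T := by
  classical
  have hc0 : 0 ≤ ν.real {c} := measureReal_nonneg
  set l := 2 * L / t with hl
  have hl0 : 0 ≤ l := by positivity
  have hl1 : l ≤ 1 := (div_le_one ht).2 htL
  have hlt : l * t = 2 * L := div_mul_cancel₀ _ ht.ne'
  have hl2 : S.card * r * l ^ 2 ≤ L := by
    have h1 : S.card * r * l ^ 2 = 4 * (S.card * r) * L * L / t ^ 2 := by
      rw [hl, div_pow]; ring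
    rw [h1, div_le_iff₀ (by positivity)]
    nlinarith
  have hpt : ∀ x : ι → α,
      (if T ≤ occ c S x ∧ t < |(occ a S x : ℝ) - r * (S.card - occ c S x)| then (1 : ℝ) else 0) ≤
      ∑ k ∈ Finset.Icc T S.card, Real.exp (-(2 * L)) *
        ((if occ c S x = k then Real.exp (l * (occ a S x - r * (S.card - occ c S x))) else 0) +
        (if occ c S x = k then
          Real.exp ((-l) * (occ a S x - r * (S.card - occ c S x))) else 0)) := by
    intro x
    have hnn : ∀ k ∈ Finset.Icc T S.card, (0 : ℝ) ≤ Real.exp (-(2 * L)) *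
        ((if occ c S x = k then Real.exp (l * (occ a S x - r * (S.card - occ c S x))) else 0) +
        (if occ c S x = k then
          Real.exp ((-l) * (occ a S x - r * (S.card - occ c S x))) else 0)) := by
      intro k _
      split_ifs <;> positivity
    split_ifs with h
    · refine le_trans ?_ (Finset.single_le_sum hnn
        (Finset.mem_Icc.2 ⟨h.1, occ_le_card c S x⟩))
      simp only [if_true]
      set D := (occ a S x : ℝ) - r * (S.card - occ c S x)
      rw [mul_add, ← Real.exp_add, ← Real.exp_add]
      rcases lt_abs.1 h.2 with h2 | h2
      · have h3 : 1 ≤ Real.exp (-(2 * L) + l * D) := Real.one_le_exp (by nlinarith)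
        linarith [Real.exp_pos (-(2 * L) + -l * D)]
      · have h3 : 1 ≤ Real.exp (-(2 * L) + -l * D) := Real.one_le_exp (by nlinarith)
        linarith [Real.exp_pos (-(2 * L) + l * D)]
    · exact Finset.sum_nonneg hnn
  rw [measureReal_eq_integral_ite]
  refine (integral_mono Integrable.of_finite Integrable.of_finite hpt).trans ?_
  rw [integral_finsetSum _ fun _ _ => Integrable.of_finite, binomTail, Finset.mul_sum]
  refine Finset.sum_le_sum fun k _ => ?_
  rw [integral_const_mul, integral_add Integrable.of_finite Integrable.of_finite]
  have hb := binomMass_nonneg (m := S.card) hc0 hc.le k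
  have h1 := integral_ite_occ_exp_le ν hac hc S k hr hr1 (l := l) (by rwa [abs_of_nonneg hl0])
  have h2 := integral_ite_occ_exp_le ν hac hc S k hr hr1 (l := -l)
    (by rwa [abs_neg, abs_of_nonneg hl0])
  rw [neg_sq] at h2
  have h3 : binomMass S.card (ν.real {c}) k * Real.exp (S.card * r * l ^ 2) ≤
      binomMass S.card (ν.real {c}) k * Real.exp L := by gcongr
  calc _ ≤ Real.exp (-(2 * L)) * (2 * (binomMass S.card (ν.real {c}) k * Real.exp L)) := by
        gcongr; linarith
    _ = 2 * (Real.exp (-(2 * L)) * Real.exp L) * binomMass S.card (ν.real {c}) k := by ring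
    _ = _ := by rw [← Real.exp_add]; ring_nf

end Law

/-! ### Degree sequences -/

/-- An enumeration of the vertices that realizes the decreasing degree sequence. -/
lemma exists_perm_degree_eq_degSeq {n : ℕ} (G : SimpleGraph (Fin n)) [DecidableRel G.Adj] :
    ∃ σ : Equiv.Perm (Fin n), Antitone (fun i => G.degree (σ i)) ∧
      ∀ i : Fin n, G.degree (σ i) = degSeq G (i + 1) := by
  classical
  obtain ⟨σ, hσ⟩ : ∃ σ : Equiv.Perm (Fin n), Antitone (fun i => G.degree (σ i)) := by
    refine ⟨Tuple.sort (fun v => OrderDual.toDual (G.degree v)), ?_⟩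
    exact fun i j hij => Tuple.monotone_sort (fun v => OrderDual.toDual (G.degree v)) hij
  refine ⟨σ, hσ, fun i => ?_⟩
  have hlist : degreeList G = List.ofFn (fun i => G.degree (σ i)) := by
    unfold degreeList
    refine List.Perm.eq_of_pairwise' (r := (· ≥ ·)) ?_ ?_ ?_
    · exact Multiset.pairwise_sort _ _
    · rw [List.pairwise_ofFn]
      exact fun i j hij => hσ hij.le
    · rw [← Multiset.coe_eq_coe, Multiset.sort_eq]
      have h1 : (Finset.univ.val.map fun i => G.degree (σ i)) =
          ((List.ofFn fun i => G.degree (σ i) : List ℕ) : Multiset ℕ) := by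
        rw [Fin.univ_val_map]
      rw [← h1]
      have h2 := congrArg (Multiset.map fun v => G.degree v)
        (congrArg Finset.val (Finset.map_univ_equiv σ))
      rw [Finset.map_val, Multiset.map_map] at h2
      rw [← show Multiset.map (fun v => G.degree v) Finset.univ.val =
        Multiset.map (fun i => G.degree (σ i)) Finset.univ.val from h2.symm]
      refine Multiset.map_congr rfl fun v _ => ?_
      congr!
  simp [degSeq, hlist]

/-- If each vertex of the list `w` has a degree that exceeds by more than `2` the degrees of all
vertices that do not precede it, then `w` is the only list of vertices of largest degrees, and the
largest degrees are separated. -/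
lemma eq_and_degreeSeparated {n h : ℕ} (hn : h < n) (G : SimpleGraph (Fin n))
    [DecidableRel G.Adj] (w : Fin h → Fin n) (hw : Function.Injective w)
    (hgap : ∀ i : Fin h, ∀ v, (∀ j ≤ i, v ≠ w j) → G.degree v + 2 < G.degree (w i))
    (g : Fin h → Fin n) (hg : ∀ i : Fin h, G.degree (g i) = degSeq G (i + 1)) :
    g = w ∧ DegreeSeparated h G := by
  classical
  obtain ⟨σ, hσ, hdeg⟩ := exists_perm_degree_eq_degSeq G
  have hσw : ∀ i : ℕ, ∀ hi : i < h, σ ⟨i, by omega⟩ = w ⟨i, hi⟩ := by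
    intro i
    induction i using Nat.strong_induction_on with
    | _ i ih =>
      intro hi
      by_contra hne
      have h1 : ∀ j ≤ (⟨i, hi⟩ : Fin h), σ ⟨i, by omega⟩ ≠ w j := by
        intro j hj
        rcases lt_or_eq_of_le hj with h2 | h2
        · rw [← ih j h2 j.2]
          intro h3
          have := congrArg Fin.val (σ.injective h3)
          simp only at this
          have : (j : ℕ) < i := h2
          omega
        · rw [h2]; exact hne
      have h2 := hgap ⟨i, hi⟩ _ h1
      obtain ⟨l, hl⟩ := σ.surjective (w ⟨i, hi⟩)
      have h3 : i ≤ (l : ℕ) := by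
        by_contra! h4
        have h5 := ih l h4 (by omega)
        have h6 : w ⟨l, by omega⟩ = w ⟨i, hi⟩ := by rw [← h5, ← hl]
        have := congrArg Fin.val (hw h6)
        simp only at this
        omega
      have h4 : G.degree (σ l) ≤ G.degree (σ ⟨i, by omega⟩) := hσ (Fin.le_def.2 h3)
      rw [hl] at h4
      omega
  have hdw : ∀ i : ℕ, ∀ hi : i < h, degSeq G (i + 1) = G.degree (w ⟨i, hi⟩) := by
    intro i hi
    rw [← hσw i hi, hdeg]
  refine ⟨funext fun i => ?_, fun i hi => ?_⟩
  · have h1 : G.degree (g i) = G.degree (w i) := by rw [hg, hdw i i.2]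
    by_contra hne
    by_cases h2 : ∀ j ≤ i, g i ≠ w j
    · have := hgap i _ h2
      omega
    · push Not at h2
      obtain ⟨j, hj, hj'⟩ := h2
      have hji : j < i := lt_of_le_of_ne hj fun h3 => hne (h3 ▸ hj')
      have h3 := hgap j (w i) fun k hk h4 => by
        have := hw h4
        subst this
        exact absurd hji (not_lt.2 hk)
      rw [hj'] at h1
      omega
  · obtain ⟨hi1, hi2⟩ := hi
    obtain ⟨i, rfl⟩ : ∃ j, i = j + 1 := ⟨i - 1, by omega⟩
    have h1 := hdeg ⟨i + 1, by omega⟩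
    rw [hdw i (by omega), ← h1]
    refine hgap ⟨i, by omega⟩ _ fun j hj h2 => ?_
    rw [← hσw j j.2] at h2
    have h3 := congrArg Fin.val (σ.injective h2)
    have h4 : (j : ℕ) ≤ i := hj
    simp only at h3
    omega

/-! ### Degrees in the correlated random graphs -/

/-- The potential edges at the vertex `v`. -/
def starAt {n : ℕ} (v : Fin n) : Finset (Pairs (Fin n)) :=
  Finset.univ.filter fun e => v ∈ e.1

/-- Potential edges at `v` with a given property correspond to their other endpoints. -/
lemma card_filter_starAt {n : ℕ} (v : Fin n) (P : Pairs (Fin n) → Prop) [DecidablePred P]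
    [DecidablePred fun u => ∃ he : ¬ s(v, u).IsDiag, P ⟨s(v, u), he⟩] :
    (Finset.univ.filter fun u => ∃ he : ¬ s(v, u).IsDiag, P ⟨s(v, u), he⟩).card =
      ((starAt v).filter P).card := by
  refine Finset.card_bij (fun u hu => ⟨s(v, u), (Finset.mem_filter.1 hu).2.1⟩) ?_ ?_ ?_
  · intro u hu
    have := (Finset.mem_filter.1 hu).2.2
    simp [starAt, this]
  · intro u hu u' hu' h
    have h' : s(v, u) = s(v, u') := congrArg Subtype.val h
    exact Sym2.congr_right.1 h'
  · rintro ⟨e, he⟩ h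
    simp only [starAt, Finset.mem_filter, Finset.mem_univ, true_and] at h
    obtain ⟨⟨u, rfl⟩, hP⟩ := h
    exact ⟨u, by simpa using ⟨by simpa using he, hP⟩, rfl⟩

lemma card_starAt {n : ℕ} (v : Fin n) : (starAt v).card = n - 1 := by
  classical
  have h := card_filter_starAt v fun _ => True
  rw [Finset.filter_true] at h
  rw [← h, show (Finset.univ.filter fun u => ∃ _ : ¬ s(v, u).IsDiag, True) =
    Finset.univ.erase v by ext u; simp [eq_comm]]
  simp

lemma card_starAt_sdiff {n : ℕ} {u v : Fin n} (huv : u ≠ v) :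
    (starAt v \ starAt u).card = n - 2 := by
  classical
  have h := card_filter_starAt v fun e => u ∉ e.1
  rw [show (starAt v).filter (fun e => u ∉ e.1) = starAt v \ starAt u by
    ext e; simp [starAt]] at h
  rw [← h, show (Finset.univ.filter fun w => ∃ _ : ¬ s(v, w).IsDiag, u ∉ s(v, w)) =
    (Finset.univ.erase v).erase u by
      ext w
      simp only [Finset.mem_filter, Finset.mem_univ, true_and, Sym2.mk_isDiag_iff,
        Sym2.mem_iff, exists_prop, Finset.mem_erase, and_true]
      constructor
      · rintro ⟨h1, h2⟩
        exact ⟨fun h3 => h2 (Or.inr h3.symm), fun h3 => h1 h3.symm⟩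
      · rintro ⟨h1, h2⟩
        exact ⟨fun h3 => h2 h3.symm, by rintro (h3 | h3); exacts [huv h3, h1 h3.symm]⟩]
  rw [Finset.card_erase_of_mem (by simp [huv]), Finset.card_erase_of_mem (by simp)]
  simp
  omega

lemma disjoint_starAt_sdiff {n : ℕ} (u v : Fin n) :
    Disjoint (starAt v \ starAt u) (starAt u \ starAt v) :=
  disjoint_sdiff_sdiff

/-- Two stars share one potential edge, so that deleting it changes both occupation numbers by the
same amount, which is at most `1`. -/
lemma exists_occ_starAt_eq {n : ℕ} {u v : Fin n} (huv : u ≠ v) (c : Bool × Bool)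
    (x : Pairs (Fin n) → Bool × Bool) :
    ∃ i ≤ 1, occ c (starAt v) x = occ c (starAt v \ starAt u) x + i ∧
      occ c (starAt u) x = occ c (starAt u \ starAt v) x + i := by
  have hsplit : ∀ u v : Fin n, occ c (starAt v) x =
      occ c (starAt v \ starAt u) x + occ c (starAt v ∩ starAt u) x := by
    intro u v
    rw [occ, occ, occ, ← Finset.card_union_of_disjoint, ← Finset.filter_union,
      Finset.sdiff_union_inter]
    exact Finset.disjoint_filter_filter (Finset.disjoint_sdiff_inter _ _)
  refine ⟨occ c (starAt v ∩ starAt u) x, ?_, hsplit u v, ?_⟩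
  · refine (occ_le_card _ _ _).trans ?_
    have h1 := Finset.card_sdiff_add_card_inter (starAt v) (starAt u)
    rw [card_starAt_sdiff huv, card_starAt] at h1
    omega
  · rw [Finset.inter_comm]
    exact hsplit v u

/-- If the edges of `G` are the pairs where `x` takes one of two values, its degrees are sums of two
occupation numbers. -/
lemma degree_eq_occ_add_occ {n : ℕ} (x : Pairs (Fin n) → Bool × Bool) (G : SimpleGraph (Fin n))
    [DecidableRel G.Adj] {a c : Bool × Bool} (hac : a ≠ c)
    (hG : ∀ v u, G.Adj v u ↔ ∃ he : ¬ s(v, u).IsDiag, x ⟨s(v, u), he⟩ = c ∨ x ⟨s(v, u), he⟩ = a)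
    (v : Fin n) : G.degree v = occ c (starAt v) x + occ a (starAt v) x := by
  classical
  rw [occ, occ, ← Finset.card_union_of_disjoint, ← Finset.filter_or,
    ← card_filter_starAt v fun e => x e = c ∨ x e = a, ← SimpleGraph.card_neighborFinset_eq_degree]
  · congr 1
    ext u
    simp [SimpleGraph.mem_neighborFinset, hG]
  · refine Finset.disjoint_left.2 fun e h1 h2 => hac ?_
    exact (Finset.mem_filter.1 h2).2.symm.trans (Finset.mem_filter.1 h1).2

lemma degree_graphPair_fst {n : ℕ} (x : Pairs (Fin n) → Bool × Bool)
    [DecidableRel (graphPair x).1.Adj] (v : Fin n) :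
    (graphPair x).1.degree v = occ (true, true) (starAt v) x + occ (true, false) (starAt v) x := by
  refine degree_eq_occ_add_occ x _ (by simp) (fun v u => ?_) v
  rw [graphPair, SimpleGraph.fromEdgeSet_adj]
  constructor
  · rintro ⟨⟨he, h⟩, -⟩
    refine ⟨he, ?_⟩
    rcases hx : x ⟨s(v, u), he⟩ with ⟨a, b⟩
    rw [hx] at h
    cases b <;> simp_all
  · rintro ⟨he, h⟩
    refine ⟨⟨he, ?_⟩, by simpa using he⟩
    rcases h with h | h <;> rw [h]

lemma degree_graphPair_snd {n : ℕ} (x : Pairs (Fin n) → Bool × Bool)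
    [DecidableRel (graphPair x).2.Adj] (v : Fin n) :
    (graphPair x).2.degree v = occ (true, true) (starAt v) x + occ (false, true) (starAt v) x := by
  refine degree_eq_occ_add_occ x _ (by simp) (fun v u => ?_) v
  rw [graphPair, SimpleGraph.fromEdgeSet_adj]
  constructor
  · rintro ⟨⟨he, h⟩, -⟩
    refine ⟨he, ?_⟩
    rcases hx : x ⟨s(v, u), he⟩ with ⟨a, b⟩
    rw [hx] at h
    cases a <;> simp_all
  · rintro ⟨he, h⟩
    refine ⟨⟨he, ?_⟩, by simpa using he⟩
    rcases h with h | h <;> rw [h]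

/-- Transfer of gaps. If the values `d` at least `T - K` are pairwise more than `S` apart, and `A`
is close to a decreasing affine function of `d` of slope at least `-1/2`, then the `h` largest
values of `d` are also, in the same order, the `h` largest of `d + A`, with gaps above `2`. The
error `s'` allowed below `T - K` may be much larger than the error `s` allowed above. -/
lemma add_two_lt_of_gaps {n h : ℕ} (d A : Fin n → ℕ) (T K S : ℕ) {r s s' m : ℝ}
    (hr : r ≤ 1 / 2) (hS : 4 * s + 4 ≤ S) (hK : 2 * s + 2 * s' + 4 ≤ K)
    (hcount : h ≤ (Finset.univ.filter fun v => T ≤ d v).card)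
    (hgap : ∀ u v, u ≠ v → T - K ≤ d v → d v ≤ d u → d v + S < d u)
    (hs : ∀ v, T - K ≤ d v → |(A v : ℝ) - r * (m - d v)| ≤ s)
    (hs' : ∀ v, |(A v : ℝ) - r * (m - d v)| ≤ s')
    (hn : h ≤ n) (σ : Equiv.Perm (Fin n)) (hσ : Antitone (fun i => d (σ i))) (i : Fin h)
    (v : Fin n) (hv : ∀ j ≤ i, v ≠ σ (Fin.castLE hn j)) :
    d v + A v + 2 < d (σ (Fin.castLE hn i)) + A (σ (Fin.castLE hn i)) := by
  set u := σ (Fin.castLE hn i) with hu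
  have hTu : T ≤ d u := by
    by_contra! hlt
    have hsub : (Finset.univ.filter fun v => T ≤ d v) ⊆
        (Finset.Iio (Fin.castLE hn i)).map σ.toEmbedding := by
      intro w hw
      obtain ⟨l, rfl⟩ := σ.surjective w
      have hw' := (Finset.mem_filter.1 hw).2
      refine Finset.mem_map.2 ⟨l, Finset.mem_Iio.2 ?_, rfl⟩
      by_contra! hle
      have : d (σ l) ≤ d u := hσ hle
      omega
    have := Finset.card_le_card hsub
    rw [Finset.card_map, Fin.card_Iio] at this
    simp only [Fin.val_castLE] at this
    have := i.2
    omega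
  have hvu : v ≠ u := hv i le_rfl
  have hdv : d v ≤ d u := by
    obtain ⟨l, rfl⟩ := σ.surjective v
    refine hσ (Fin.le_def.2 ?_)
    by_contra! hlt
    have hl : (l : ℕ) < i := hlt
    exact hv ⟨l, by have := i.2; omega⟩ (Fin.le_def.2 hl.le) (congrArg σ (Fin.ext rfl))
  have hu1 := abs_le.1 (hs u (by omega))
  have hgoal : ((d v + A v + 2 : ℕ) : ℝ) < ((d u + A u : ℕ) : ℝ) := by
    push_cast
    rcases le_or_gt (T - K) (d v) with h1 | h1
    · have h2 : (d v + S : ℝ) < d u := by exact_mod_cast hgap u v hvu.symm h1 hdv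
      have h3 := abs_le.1 (hs v h1)
      have h4 : 0 ≤ ((d u : ℝ) - d v) * (1 / 2 - r) := by
        refine mul_nonneg ?_ (by linarith)
        have : (0 : ℝ) ≤ S := Nat.cast_nonneg _
        linarith
      nlinarith
    · have h2 : (d v + K : ℝ) < d u := by
        have : d v + K < d u := by omega
        exact_mod_cast this
      have h3 := abs_le.1 (hs' v)
      have h4 : 0 ≤ ((d u : ℝ) - d v) * (1 / 2 - r) := by
        refine mul_nonneg ?_ (by linarith)
        have : (0 : ℝ) ≤ K := Nat.cast_nonneg _
        linarith
      nlinarith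
  exact_mod_cast hgoal

section Events

variable {n : ℕ} (ν : Measure (Bool × Bool)) [IsProbabilityMeasure ν] (c : Bool × Bool)

/-- Two degrees cannot both be large much more often than if they were independent. -/
lemma measureReal_le_occ_and_le_occ {u v : Fin n} (huv : u ≠ v) (T : ℕ) :
    (Measure.pi fun _ : Pairs (Fin n) => ν).real
        {x | T ≤ occ c (starAt u) x ∧ T ≤ occ c (starAt v) x} ≤
      binomTail (n - 2) (ν.real {c}) (T - 1) ^ 2 := by
  have h := measureReal_occ_inter ν (c := c) (disjoint_starAt_sdiff v u)
    (Set.Ici (T - 1)) (Set.Ici (T - 1))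
  simp only [Set.mem_Ici] at h
  rw [measureReal_le_occ, measureReal_le_occ, card_starAt_sdiff huv,
    card_starAt_sdiff huv.symm, ← sq] at h
  rw [← h]
  refine measureReal_mono fun x hx => ?_
  obtain ⟨i, hi, h1, h2⟩ := exists_occ_starAt_eq huv c x
  have hx1 : T ≤ occ c (starAt u) x := hx.1
  have hx2 : T ≤ occ c (starAt v) x := hx.2
  exact ⟨by omega, by omega⟩

lemma binomTail_le_measureReal {u v : Fin n} (huv : u ≠ v) (T : ℕ) :
    binomTail (n - 2) (ν.real {c}) T ≤
      (Measure.pi fun _ : Pairs (Fin n) => ν).real {x | T ≤ occ c (starAt v) x} := by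
  rw [← card_starAt_sdiff huv, ← measureReal_le_occ]
  exact measureReal_mono fun x hx => le_trans hx (occ_mono c Finset.sdiff_subset x)

lemma measureReal_le_binomTail {u v : Fin n} (huv : u ≠ v) (T : ℕ) :
    (Measure.pi fun _ : Pairs (Fin n) => ν).real {x | T ≤ occ c (starAt v) x} ≤
      binomTail (n - 2) (ν.real {c}) (T - 1) := by
  rw [← card_starAt_sdiff huv, ← measureReal_le_occ]
  refine measureReal_mono fun x hx => ?_
  obtain ⟨i, hi, h1, h2⟩ := exists_occ_starAt_eq huv c x
  have hx1 : T ≤ occ c (starAt v) x := hx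
  exact (show T - 1 ≤ occ c (starAt v \ starAt u) x by omega)

/-- Second moment bound: few vertices of degree at least `T` are unlikely. -/
lemma measureReal_card_lt_le (hn : 2 ≤ n) {h T : ℕ} {η : ℝ} (hh : 0 < h) (hη0 : 0 ≤ η)
    (hη1 : η ≤ 1 / 2)
    (hT : 2 * (h / n : ℝ) ≤ binomTail (n - 2) (ν.real {c}) T)
    (hT1 : binomTail (n - 2) (ν.real {c}) (T - 1) ≤
      (1 + 2 * η) * binomTail (n - 2) (ν.real {c}) T) :
    (Measure.pi fun _ : Pairs (Fin n) => ν).real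
        {x | (Finset.univ.filter fun v => T ≤ occ c (starAt v) x).card < h} ≤
      4 / h + 24 * η := by
  classical
  set μ := Measure.pi fun _ : Pairs (Fin n) => ν
  set B := binomTail (n - 2) (ν.real {c}) T
  set B' := binomTail (n - 2) (ν.real {c}) (T - 1)
  have hn0 : (0 : ℝ) < n := by positivity
  have hh0 : (0 : ℝ) < h := by exact_mod_cast hh
  have hother : ∀ v : Fin n, ∃ u, u ≠ v := fun v => by
    have : Nontrivial (Fin n) := Fin.nontrivial_iff_two_le.2 hn
    exact exists_ne v
  set a := n * B with ha
  have ha2 : 2 * h ≤ a := by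
    have := mul_le_mul_of_nonneg_left hT hn0.le
    rwa [show (n : ℝ) * (2 * (h / n)) = 2 * h by field_simp] at this
  have ha0 : 0 < a := by linarith
  have hB0 : 0 ≤ B := by
    by_contra! hneg
    nlinarith
  have hB'0 : 0 ≤ B' := binomTail_nonneg measureReal_nonneg measureReal_le_one _
  set E : Fin n → Set (Pairs (Fin n) → Bool × Bool) := fun v => {x | T ≤ occ c (starAt v) x}
  have hcheb := measureReal_card_lt_mul_le μ E ha0.le
  have h1 : a ≤ ∑ v, μ.real (E v) := by
    have : ∑ _v : Fin n, B ≤ ∑ v, μ.real (E v) := Finset.sum_le_sum fun v _ => by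
      obtain ⟨u, hu⟩ := hother v
      exact binomTail_le_measureReal ν c hu T
    simpa using this
  have h2 : ∑ u, ∑ v, μ.real (E u ∩ E v) ≤ n * B' + n ^ 2 * B' ^ 2 := by
    have h3 : ∀ u v, μ.real (E u ∩ E v) ≤ (if u = v then B' else 0) + B' ^ 2 := by
      intro u v
      rcases eq_or_ne u v with rfl | huv
      · obtain ⟨w, hw⟩ := hother u
        rw [Set.inter_self, if_pos rfl]
        have : μ.real (E u) ≤ B' := measureReal_le_binomTail ν c hw T
        nlinarith
      · rw [if_neg huv, zero_add]
        exact measureReal_le_occ_and_le_occ ν c huv T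
    refine (Finset.sum_le_sum fun u _ => Finset.sum_le_sum fun v _ => h3 u v).trans ?_
    simp only [Finset.sum_add_distrib, Finset.sum_ite_eq, Finset.mem_univ, if_true,
      Finset.sum_const, Finset.card_univ, Fintype.card_fin, nsmul_eq_mul]
    nlinarith
  have h4 : n * B' ≤ (1 + 2 * η) * a := by
    have := mul_le_mul_of_nonneg_left hT1 hn0.le
    rw [ha]; linarith
  have h5 : n ^ 2 * B' ^ 2 ≤ (1 + 2 * η) ^ 2 * a ^ 2 := by
    rw [← mul_pow, ← mul_pow]
    exact pow_le_pow_left₀ (by positivity) h4 2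
  have h6 : μ.real {x | ((Finset.univ.filter fun v => x ∈ E v).card : ℝ) < a / 2} *
      (a / 2) ^ 2 ≤ 2 * a + 6 * η * a ^ 2 := by
    refine hcheb.trans ?_
    have h7 := mul_le_mul_of_nonneg_left h1 (show 0 ≤ 2 * a by positivity)
    have h8 : η * a ≤ a / 2 := by nlinarith
    have h9 : η * η * a ^ 2 ≤ η / 2 * a ^ 2 :=
      mul_le_mul_of_nonneg_right (by nlinarith) (sq_nonneg a)
    nlinarith
  have h7 : μ.real {x | (Finset.univ.filter fun v => T ≤ occ c (starAt v) x).card < h} ≤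
      μ.real {x | ((Finset.univ.filter fun v => x ∈ E v).card : ℝ) < a / 2} := by
    refine measureReal_mono fun x hx => ?_
    have hx' : (Finset.univ.filter fun v => T ≤ occ c (starAt v) x).card < h := hx
    have h8 : ((Finset.univ.filter fun v => T ≤ occ c (starAt v) x).card : ℝ) < h := by
      exact_mod_cast hx'
    have h9 : (Finset.univ.filter fun v => x ∈ E v) =
        Finset.univ.filter fun v => T ≤ occ c (starAt v) x := by
      ext v; simp [E]
    rw [Set.mem_ofPred_eq, h9]
    linarith
  refine h7.trans ?_
  rw [← le_div_iff₀ (by positivity)] at h6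
  refine h6.trans ?_
  rw [show (2 * a + 6 * η * a ^ 2) / (a / 2) ^ 2 = 8 / a + 24 * η by field_simp; ring]
  have : 8 / a ≤ 4 / h := by
    rw [div_le_div_iff₀ ha0 hh0]
    linarith
  linarith

/-- First moment bound: two vertices of large and almost equal degrees are unlikely. -/
lemma measureReal_exists_close_le {h T K S : ℕ} {η : ℝ} (hn : 0 < n)
    (hTK : binomTail (n - 2) (ν.real {c}) (T - (K + 1)) ≤ 8 * (h / n))
    (hmass : ∀ k, T - (K + 1) ≤ k → binomMass (n - 2) (ν.real {c}) k ≤ 8 * (h / n) * η) :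
    (Measure.pi fun _ : Pairs (Fin n) => ν).real
        {x | ∃ u v, u ≠ v ∧ T - K ≤ occ c (starAt v) x ∧
          occ c (starAt v) x ≤ occ c (starAt u) x ∧
          occ c (starAt u) x ≤ occ c (starAt v) x + S} ≤
      64 * h ^ 2 * (S + 1) * η := by
  classical
  set μ := Measure.pi fun _ : Pairs (Fin n) => ν
  have hp0 : 0 ≤ ν.real {c} := measureReal_nonneg
  have hp1 : ν.real {c} ≤ 1 := measureReal_le_one
  have hn0 : (0 : ℝ) < n := by exact_mod_cast hn
  have hmass0 : 0 ≤ 8 * (h / n : ℝ) * η :=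
    (binomMass_nonneg (m := n - 2) hp0 hp1 _).trans (hmass _ le_rfl)
  set Q : ℝ := (S + 1) * (8 * (h / n) * η) * (8 * (h / n)) with hQ
  have hQ0 : 0 ≤ Q := by positivity
  have hpair : ∀ u v : Fin n, μ.real {x | u ≠ v ∧ T - K ≤ occ c (starAt v) x ∧
      occ c (starAt v) x ≤ occ c (starAt u) x ∧
      occ c (starAt u) x ≤ occ c (starAt v) x + S} ≤ Q := by
    intro u v
    rcases eq_or_ne u v with rfl | huv
    · simp [hQ0]
    have hsub : {x : Pairs (Fin n) → Bool × Bool | u ≠ v ∧ T - K ≤ occ c (starAt v) x ∧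
        occ c (starAt v) x ≤ occ c (starAt u) x ∧
        occ c (starAt u) x ≤ occ c (starAt v) x + S} ⊆
        ⋃ j ∈ Finset.Icc (T - (K + 1)) (n - 2), {x | occ c (starAt v \ starAt u) x ∈ ({j} : Set ℕ) ∧
          occ c (starAt u \ starAt v) x ∈ Set.Icc j (j + S)} := by
      rintro x ⟨-, h1, h2, h3⟩
      obtain ⟨i, hi, h4, h5⟩ := exists_occ_starAt_eq huv c x
      have h6 := occ_le_card c (starAt v \ starAt u) x
      rw [card_starAt_sdiff huv] at h6
      simp only [Set.mem_iUnion, Finset.mem_Icc]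
      exact ⟨occ c (starAt v \ starAt u) x, ⟨by omega, h6⟩, rfl, by omega, by omega⟩
    refine (measureReal_mono hsub (measure_ne_top _ _)).trans ((measureReal_biUnion_finset_le _ _).trans ?_)
    have hterm : ∀ j ∈ Finset.Icc (T - (K + 1)) (n - 2),
        μ.real {x | occ c (starAt v \ starAt u) x ∈ ({j} : Set ℕ) ∧
          occ c (starAt u \ starAt v) x ∈ Set.Icc j (j + S)} ≤
        binomMass (n - 2) (ν.real {c}) j * ((S + 1) * (8 * (h / n) * η)) := by
      intro j hj
      have hj1 := (Finset.mem_Icc.1 hj).1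
      rw [measureReal_occ_inter ν (disjoint_starAt_sdiff u v)]
      have h1 := measureReal_occ_eq ν c (starAt v \ starAt u) j
      rw [card_starAt_sdiff huv] at h1
      have h2 : μ.real {x | occ c (starAt u \ starAt v) x ∈ Set.Icc j (j + S)} ≤
          (S + 1) * (8 * (h / n) * η) := by
        have h3 : {x : Pairs (Fin n) → Bool × Bool |
            occ c (starAt u \ starAt v) x ∈ Set.Icc j (j + S)} ⊆
            ⋃ k ∈ Finset.Icc j (j + S), {x | occ c (starAt u \ starAt v) x = k} := by
          intro x hx
          simpa using hx
        refine (measureReal_mono h3 (measure_ne_top _ _)).trans ((measureReal_biUnion_finset_le _ _).trans ?_)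
        have h4 : ∀ k ∈ Finset.Icc j (j + S),
            μ.real {x | occ c (starAt u \ starAt v) x = k} ≤ 8 * (h / n) * η := by
          intro k hk
          rw [measureReal_occ_eq, card_starAt_sdiff huv.symm]
          exact hmass k (hj1.trans (Finset.mem_Icc.1 hk).1)
        refine (Finset.sum_le_card_nsmul _ _ _ h4).trans (le_of_eq ?_)
        rw [Nat.card_Icc, nsmul_eq_mul, show j + S + 1 - j = S + 1 by omega]
        push_cast
        ring
      simp only [Set.mem_singleton_iff]
      rw [h1]
      exact mul_le_mul_of_nonneg_left h2 (binomMass_nonneg hp0 hp1 j)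
    refine (Finset.sum_le_sum hterm).trans ?_
    rw [← Finset.sum_mul, mul_comm]
    exact mul_le_mul_of_nonneg_left hTK (by positivity)
  have hunion : {x : Pairs (Fin n) → Bool × Bool | ∃ u v, u ≠ v ∧ T - K ≤ occ c (starAt v) x ∧
      occ c (starAt v) x ≤ occ c (starAt u) x ∧
      occ c (starAt u) x ≤ occ c (starAt v) x + S} =
      ⋃ u, ⋃ v, {x | u ≠ v ∧ T - K ≤ occ c (starAt v) x ∧
        occ c (starAt v) x ≤ occ c (starAt u) x ∧
        occ c (starAt u) x ≤ occ c (starAt v) x + S} := by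
    ext x
    simp
  rw [hunion]
  refine (measureReal_iUnion_fintype_le _).trans ?_
  refine (Finset.sum_le_sum fun u _ => (measureReal_iUnion_fintype_le _).trans
    (Finset.sum_le_sum fun v _ => hpair u v)).trans (le_of_eq ?_)
  simp only [Finset.sum_const, Finset.card_univ, Fintype.card_fin, nsmul_eq_mul]
  rw [hQ]
  field_simp
  ring

/-- Union bound for the deviations of `occ a` at the vertices where `occ c` is at least `T'`. -/
lemma measureReal_exists_deviation_le {a : Bool × Bool} (hac : a ≠ c) (hc : ν.real {c} < 1)
    (T' : ℕ) {r t L B : ℝ} (hr : ν.real {a} = r * (1 - ν.real {c})) (hr0 : 0 ≤ r) (hr1 : r ≤ 1)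
    (ht : 0 < t) (hL : 0 ≤ L) (htL : 2 * L ≤ t) (htL2 : 4 * (n * r) * L ≤ t ^ 2)
    (hB : ∀ v : Fin n,
      (Measure.pi fun _ : Pairs (Fin n) => ν).real {x | T' ≤ occ c (starAt v) x} ≤ B) :
    (Measure.pi fun _ : Pairs (Fin n) => ν).real
        {x | ∃ v, T' ≤ occ c (starAt v) x ∧
          t < |(occ a (starAt v) x : ℝ) - r * ((n - 1 : ℕ) - occ c (starAt v) x)|} ≤
      2 * n * Real.exp (-L) * B := by
  have hunion : {x : Pairs (Fin n) → Bool × Bool | ∃ v, T' ≤ occ c (starAt v) x ∧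
      t < |(occ a (starAt v) x : ℝ) - r * ((n - 1 : ℕ) - occ c (starAt v) x)|} =
      ⋃ v, {x | T' ≤ occ c (starAt v) x ∧
        t < |(occ a (starAt v) x : ℝ) - r * ((n - 1 : ℕ) - occ c (starAt v) x)|} := by
    ext x
    simp
  rw [hunion]
  have hv : ∀ v : Fin n, (Measure.pi fun _ : Pairs (Fin n) => ν).real
      {x | T' ≤ occ c (starAt v) x ∧
        t < |(occ a (starAt v) x : ℝ) - r * ((n - 1 : ℕ) - occ c (starAt v) x)|} ≤
      2 * Real.exp (-L) * B := by
    intro v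
    have h1 := measureReal_occ_deviation_le ν hac hc (starAt v) T' hr hr1 ht hL htL (by
      refine le_trans ?_ htL2
      rw [card_starAt]
      have : ((n - 1 : ℕ) : ℝ) ≤ n := by exact_mod_cast Nat.sub_le n 1
      gcongr)
    rw [← measureReal_le_occ, card_starAt] at h1
    exact h1.trans (mul_le_mul_of_nonneg_left (hB v) (by positivity))
  refine (measureReal_iUnion_fintype_le _).trans
    ((Finset.sum_le_sum fun v _ => hv v).trans (le_of_eq ?_))
  simp only [Finset.sum_const, Finset.card_univ, Fintype.card_fin, nsmul_eq_mul]
  ring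

end Events

/-! ### Probability of success -/

lemma EdgeLaw.measureReal_singleton (p : EdgeLaw) (b : Bool × Bool) :
    p.pmf.toMeasure.real {b} = p.prob b := by
  rw [Measure.real, PMF.toMeasure_apply_singleton _ _ (measurableSet_singleton b), EdgeLaw.pmf,
    PMF.ofFintype_apply, ENNReal.toReal_ofReal (p.prob_nonneg b)]

/-- Finite form of the result: a lower bound for the probability of success in terms of a threshold
`T`, the width `K` of a window below it, a gap `S`, and a bound `η` for the hazard rate. -/
lemma one_sub_le_correlatedER_real {n h : ℕ} (p : EdgeLaw) {T K S : ℕ} {η s s' L L' : ℝ}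
    (hh : 0 < h) (hn2 : 2 ≤ n) (hhn : h < n) (hη0 : 0 ≤ η) (hη1 : η ≤ 1 / 2)
    (h00 : 3 / 4 ≤ p.p00)
    (hT : 2 * (h / n : ℝ) ≤ binomTail (n - 2) p.p11 T)
    (hT1 : binomTail (n - 2) p.p11 (T - 1) ≤ (1 + 2 * η) * binomTail (n - 2) p.p11 T)
    (hTK : binomTail (n - 2) p.p11 (T - (K + 1)) ≤ 8 * (h / n))
    (hmass : ∀ k, T - (K + 1) ≤ k → binomMass (n - 2) p.p11 k ≤ 8 * (h / n) * η)
    (hs0 : 0 < s) (hs0' : 0 < s') (hL0 : 0 ≤ L) (hL0' : 0 ≤ L')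
    (hS : 4 * s + 4 ≤ S) (hK : 2 * s + 2 * s' + 4 ≤ K)
    (hL : 2 * L ≤ s) (hL2 : 8 * (n * (p.p01 + p.p10)) * L ≤ s ^ 2)
    (hL' : 2 * L' ≤ s') (hL2' : 8 * (n * (p.p01 + p.p10)) * L' ≤ s' ^ 2)
    (f : SimpleGraph (Fin n) → (Fin h → Fin n)) (hf : IsHighDegreeSorting f) :
    1 - (4 / h + 24 * η + 64 * h ^ 2 * (S + 1) * η +
        (32 * (h * Real.exp (-L)) + 4 * (n * Real.exp (-L')))) ≤
      (correlatedER n p).real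
        {G | f G.1 = f G.2 ∧ DegreeSeparated h G.1 ∧ DegreeSeparated h G.2} := by
  classical
  set ν := p.pmf.toMeasure with hν
  set μ := Measure.pi fun _ : Pairs (Fin n) => ν with hμ
  have hn0 : (0 : ℝ) < n := by positivity
  have hc : ν.real {(true, true)} = p.p11 := p.measureReal_singleton _
  have hsum := p.sum_eq_one
  have h10 := p.p10_nonneg
  have h01 := p.p01_nonneg
  have h11 := p.p11_nonneg
  have hc1 : ν.real {(true, true)} < 1 := by rw [hc]; linarith
  have hother : ∀ v : Fin n, ∃ u, u ≠ v := fun v => by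
    have : Nontrivial (Fin n) := Fin.nontrivial_iff_two_le.2 hn2
    exact exists_ne v
  set d : (Pairs (Fin n) → Bool × Bool) → Fin n → ℕ := fun x v => occ (true, true) (starAt v) x
  -- the deviations of the two kinds of additional edges are bounded in the same way
  have hdev : ∀ a : Bool × Bool, a ≠ (true, true) → p.prob a ≤ p.p01 + p.p10 →
      ∃ r : ℝ, r ≤ 1 / 2 ∧
        μ.real {x | ∃ v, T - K ≤ d x v ∧
          s < |(occ a (starAt v) x : ℝ) - r * ((n - 1 : ℕ) - d x v)|} ≤
            16 * (h * Real.exp (-L)) ∧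
        μ.real {x | ∃ v, 0 ≤ d x v ∧
          s' < |(occ a (starAt v) x : ℝ) - r * ((n - 1 : ℕ) - d x v)|} ≤
            2 * (n * Real.exp (-L')) := by
    intro a hac ha
    have ha0 := p.prob_nonneg a
    have hpos : 0 < 1 - p.p11 := by linarith
    have hr : ν.real {a} = p.prob a / (1 - p.p11) * (1 - ν.real {(true, true)}) := by
      rw [hc, div_mul_cancel₀ _ hpos.ne']
      exact p.measureReal_singleton _
    have hr0 : 0 ≤ p.prob a / (1 - p.p11) := by positivity
    have hr2 : p.prob a / (1 - p.p11) ≤ 2 * (p.p01 + p.p10) := by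
      rw [div_le_iff₀ hpos]
      nlinarith
    have hr1 : p.prob a / (1 - p.p11) ≤ 1 / 2 := by linarith
    refine ⟨p.prob a / (1 - p.p11), hr1, ?_, ?_⟩
    · have h1 := measureReal_exists_deviation_le (n := n) ν (true, true) hac hc1 (T - K)
        hr hr0 (by linarith) hs0 hL0 hL (le_trans (by
          have := mul_le_mul_of_nonneg_right (mul_le_mul_of_nonneg_left hr2 hn0.le) hL0
          linarith) hL2) (B := 8 * (h / n)) (fun v => by
          obtain ⟨u, hu⟩ := hother v
          refine (measureReal_le_binomTail ν (true, true) hu (T - K)).trans ?_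
          rw [hc, Nat.sub_sub]
          exact hTK)
      refine h1.trans (le_of_eq ?_)
      field_simp
      ring
    · have h1 := measureReal_exists_deviation_le (n := n) ν (true, true) hac hc1 0
        hr hr0 (by linarith) hs0' hL0' hL' (le_trans (by
          have := mul_le_mul_of_nonneg_right (mul_le_mul_of_nonneg_left hr2 hn0.le) hL0'
          linarith) hL2') (B := 1) (fun v => measureReal_le_one)
      refine h1.trans (le_of_eq ?_)
      ring
  obtain ⟨r₁, hr₁, h1s, h1s'⟩ := hdev (true, false) (by simp) (by simp [EdgeLaw.prob, h01])
  obtain ⟨r₂, hr₂, h2s, h2s'⟩ := hdev (false, true) (by simp) (by simp [EdgeLaw.prob, h10])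
  have hcount := measureReal_card_lt_le (n := n) ν (true, true) hn2 hh hη0 hη1
    (hc.symm ▸ hT) (hc.symm ▸ hT1)
  have hclose := measureReal_exists_close_le (n := n) ν (true, true) (h := h) (T := T) (K := K)
    (S := S) (η := η) (by omega) (hc.symm ▸ hTK) (hc.symm ▸ hmass)
  set b₁ := {x | (Finset.univ.filter fun v => T ≤ d x v).card < h} with hb₁
  set b₂ := {x | ∃ u v, u ≠ v ∧ T - K ≤ d x v ∧ d x v ≤ d x u ∧ d x u ≤ d x v + S} with hb₂
  set b₃ := {x | ∃ v, T - K ≤ d x v ∧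
    s < |(occ (true, false) (starAt v) x : ℝ) - r₁ * ((n - 1 : ℕ) - d x v)|} with hb₃
  set b₄ := {x | ∃ v, 0 ≤ d x v ∧
    s' < |(occ (true, false) (starAt v) x : ℝ) - r₁ * ((n - 1 : ℕ) - d x v)|} with hb₄
  set b₅ := {x | ∃ v, T - K ≤ d x v ∧
    s < |(occ (false, true) (starAt v) x : ℝ) - r₂ * ((n - 1 : ℕ) - d x v)|} with hb₅
  set b₆ := {x | ∃ v, 0 ≤ d x v ∧
    s' < |(occ (false, true) (starAt v) x : ℝ) - r₂ * ((n - 1 : ℕ) - d x v)|} with hb₆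
  set good := {G : SimpleGraph (Fin n) × SimpleGraph (Fin n) |
    f G.1 = f G.2 ∧ DegreeSeparated h G.1 ∧ DegreeSeparated h G.2} with hgood
  have hcover : (Set.univ : Set (Pairs (Fin n) → Bool × Bool)) ⊆
      graphPair ⁻¹' good ∪ (b₁ ∪ (b₂ ∪ ((b₃ ∪ b₄) ∪ (b₅ ∪ b₆)))) := by
    intro x _
    by_contra hx
    simp only [Set.mem_union, not_or] at hx
    obtain ⟨hx0, hx1, hx2, ⟨hx3, hx4⟩, hx5, hx6⟩ := hx
    refine hx0 ?_
    have hx1' : h ≤ (Finset.univ.filter fun v => T ≤ d x v).card := not_lt.1 hx1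
    have hx2' : ∀ u v, u ≠ v → T - K ≤ d x v → d x v ≤ d x u → d x v + S < d x u := by
      intro u v h1 h2 h3
      by_contra! h4
      exact hx2 ⟨u, v, h1, h2, h3, h4⟩
    obtain ⟨σ, hσ⟩ : ∃ σ : Equiv.Perm (Fin n), Antitone (fun i => d x (σ i)) :=
      ⟨Tuple.sort (fun v => OrderDual.toDual (d x v)),
        fun i j hij => Tuple.monotone_sort (fun v => OrderDual.toDual (d x v)) hij⟩
    have hw : Function.Injective fun i : Fin h => σ (Fin.castLE hhn.le i) :=
      σ.injective.comp (Fin.castLE_injective hhn.le)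
    have hfst := eq_and_degreeSeparated hhn (graphPair x).1 _ hw (fun i v hv => by
      rw [degree_graphPair_fst, degree_graphPair_fst]
      exact add_two_lt_of_gaps (d x) (fun v => occ (true, false) (starAt v) x) T K S hr₁ hS hK
        hx1' hx2' (fun v h1 => not_lt.1 fun h2 => hx3 ⟨v, h1, h2⟩)
        (fun v => not_lt.1 fun h2 => hx4 ⟨v, Nat.zero_le _, h2⟩) hhn.le σ hσ i v hv)
      (f (graphPair x).1) (fun i => by convert (hf (graphPair x).1).2 i)
    have hsnd := eq_and_degreeSeparated hhn (graphPair x).2 _ hw (fun i v hv => by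
      rw [degree_graphPair_snd, degree_graphPair_snd]
      exact add_two_lt_of_gaps (d x) (fun v => occ (false, true) (starAt v) x) T K S hr₂ hS hK
        hx1' hx2' (fun v h1 => not_lt.1 fun h2 => hx5 ⟨v, h1, h2⟩)
        (fun v => not_lt.1 fun h2 => hx6 ⟨v, Nat.zero_le _, h2⟩) hhn.le σ hσ i v hv)
      (f (graphPair x).2) (fun i => by convert (hf (graphPair x).2).2 i)
    exact ⟨hfst.1.trans hsnd.1.symm, hfst.2, hsnd.2⟩
  have hle : μ.real (graphPair ⁻¹' good) ≤ (correlatedER n p).real good :=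
    ENNReal.toReal_mono (measure_ne_top _ _)
      (Measure.le_map_apply Measurable.of_discrete.aemeasurable good)
  have hone : (1 : ℝ) = μ.real Set.univ := by simp
  have hmono := measureReal_mono (μ := μ) hcover
  have hu0 := measureReal_union_le (μ := μ) (graphPair ⁻¹' good)
    (b₁ ∪ (b₂ ∪ ((b₃ ∪ b₄) ∪ (b₅ ∪ b₆))))
  have hu1 := measureReal_union_le (μ := μ) b₁ (b₂ ∪ ((b₃ ∪ b₄) ∪ (b₅ ∪ b₆)))
  have hu2 := measureReal_union_le (μ := μ) b₂ ((b₃ ∪ b₄) ∪ (b₅ ∪ b₆))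
  have hu3 := measureReal_union_le (μ := μ) (b₃ ∪ b₄) (b₅ ∪ b₆)
  have hu4 := measureReal_union_le (μ := μ) b₃ b₄
  have hu5 := measureReal_union_le (μ := μ) b₅ b₆
  linarith

/-- The choice of the parameters. The condition `hM` says that a gap of order `√M` is smaller, by a
factor `ε`, than the least gap expected between the `h` largest degrees. -/
lemma one_sub_le_correlatedER_real_of_le {n h : ℕ} (p : EdgeLaw) {ε M : ℝ}
    (hh : 3 ≤ h) (hhn : 2 * h ≤ n) (hε0 : 0 < ε) (hε1 : ε ≤ 1 / 10000)
    (h00 : 3 / 4 ≤ p.p00) (hlog : Real.log n ≤ h)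
    (hM1 : Real.log h ^ 2 ≤ M) (hM2 : n * (p.p01 + p.p10) * Real.log h ≤ M)
    (hM : M * (h ^ 4 * Real.log n) ≤ ε ^ 2 * (n * p.p11))
    (f : SimpleGraph (Fin n) → (Fin h → Fin n)) (hf : IsHighDegreeSorting f) :
    1 - (36 / h + 220000 * ε + 4 / n) ≤
      (correlatedER n p).real
        {G | f G.1 = f G.2 ∧ DegreeSeparated h G.1 ∧ DegreeSeparated h G.2} := by
  have hsum := p.sum_eq_one
  have h10 := p.p10_nonneg
  have h01 := p.p01_nonneg
  have h11 := p.p11_nonneg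
  have hhR : (3 : ℝ) ≤ h := by exact_mod_cast hh
  have hhnR : 2 * (h : ℝ) ≤ n := by exact_mod_cast hhn
  have hlh : 1 ≤ Real.log h := by
    rw [Real.le_log_iff_exp_le (by linarith)]
    linarith [Real.exp_one_lt_d9]
  have hln : Real.log h ≤ Real.log n := Real.log_le_log (by linarith) (by linarith)
  set l := Real.log n with hl
  have hl1 : 1 ≤ l := hlh.trans hln
  have hM0 : 1 ≤ M := (one_le_pow₀ hlh).trans hM1
  set w := √M with hw
  have hw2 : w ^ 2 = M := Real.sq_sqrt (by linarith)
  have hw1 : 1 ≤ w := by rw [hw, Real.one_le_sqrt]; exact hM0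
  have hwl : Real.log h ≤ w := Real.le_sqrt_of_sq_le hM1
  have hnp : 0 < n * p.p11 := by
    have : 0 < M * (h ^ 4 * l) := by positivity
    exact (mul_pos_iff_of_pos_left (by positivity)).1 (this.trans_le hM)
  have hn0 : (0 : ℝ) < n := by linarith
  have hp0 : 0 < p.p11 := by
    rcases h11.lt_or_eq with h1 | h1
    · exact h1
    · rw [← h1, mul_zero] at hnp; exact absurd hnp (lt_irrefl _)
  set y := √(l / (n * p.p11)) with hy
  have hy2 : y ^ 2 = l / (n * p.p11) := Real.sq_sqrt (by positivity)
  have hy0 : 0 < y := Real.sqrt_pos.2 (by positivity)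
  have hy2' : n * p.p11 * y ^ 2 = l := by rw [hy2]; field_simp
  -- the gap condition, in terms of the hazard rate `y`
  have hgap : w * h ^ 2 * y ≤ ε := by
    refine (sq_le_sq₀ (by positivity) hε0.le).1 ?_
    rw [mul_pow, mul_pow, hw2, hy2, ← mul_div_assoc, div_le_iff₀ hnp]
    linarith
  have hh2 : (h : ℝ) ≤ h ^ 2 := le_self_pow₀ (by linarith) two_ne_zero
  have hwy : w * l * y ≤ ε := by
    refine le_trans ?_ hgap
    have : l ≤ (h : ℝ) ^ 2 := hlog.trans hh2
    gcongr
  have hwy' : w * y ≤ ε := by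
    refine le_trans ?_ hwy
    exact mul_le_mul_of_nonneg_right (le_mul_of_one_le_right (by positivity) hl1) hy0.le
  have hye : y ≤ ε := (le_mul_of_one_le_left hy0.le hw1).trans hwy'
  have hm : (n : ℝ) / 2 ≤ (n - 2 : ℕ) := by
    rw [Nat.cast_sub (by omega)]
    push_cast
    linarith
  have hmy : 512 * l ≤ (n - 2 : ℕ) * p.p11 * (32 * y) ^ 2 := by
    have h1 : (n : ℝ) / 2 * (p.p11 * y ^ 2) ≤ (n - 2 : ℕ) * (p.p11 * y ^ 2) :=
      mul_le_mul_of_nonneg_right hm (by positivity)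
    linarith
  obtain ⟨k₀, hk₀, htail⟩ := exists_level_hazard_le (m := n - 2) (p := p.p11) (δ := 32 * y)
    h11 (by linarith) (by positivity) (by linarith) (by linarith)
  have hK1 : (⌈24 * w * l⌉₊ : ℝ) ≤ 24 * w * l + 1 := (Nat.ceil_lt_add_one (by positivity)).le
  have hS1 : (⌈24 * w⌉₊ : ℝ) ≤ 24 * w + 1 := (Nat.ceil_lt_add_one (by positivity)).le
  have hexpl : Real.exp (-l) = 1 / n := by
    rw [Real.exp_neg, hl, Real.exp_log hn0, one_div]
  have htail' : binomTail (n - 2) p.p11 k₀ ≤ h / n * (4 * (32 * y)) := by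
    have h1 : Real.exp (-((n - 2 : ℕ) * p.p11 * (32 * y) ^ 2 / 64)) ≤ Real.exp (-l + -l) :=
      Real.exp_le_exp.2 (by linarith)
    rw [Real.exp_add, hexpl] at h1
    have h2 : 1 / (n : ℝ) ≤ y := by
      refine (sq_le_sq₀ (by positivity) hy0.le).1 ?_
      rw [hy2, div_pow, div_le_div_iff₀ (by positivity) hnp]
      have : (n : ℝ) * p.p11 ≤ n * 1 := mul_le_mul_of_nonneg_left (by linarith) hn0.le
      have : (n : ℝ) ≤ n ^ 2 := le_self_pow₀ (by linarith) two_ne_zero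
      have : (n : ℝ) ^ 2 ≤ l * n ^ 2 := le_mul_of_one_le_left (by positivity) hl1
      linarith
    refine htail.trans (h1.trans ?_)
    calc 1 / (n : ℝ) * (1 / n) ≤ 1 / n * y := by gcongr
      _ ≤ h / n * (4 * (32 * y)) := by
          have : 1 / (n : ℝ) ≤ h / n := by gcongr; linarith
          exact mul_le_mul this (by linarith) hy0.le (by positivity)
  obtain ⟨T, hT, hT1, hTK, hmass⟩ := exists_threshold (m := n - 2) (p := p.p11)
    (η := 4 * (32 * y)) (x := h / n) (k₀ := k₀) (K := ⌈24 * w * l⌉₊ + 1) h11 (by linarith)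
    (by positivity) (by linarith) (by positivity)
    (by rw [← mul_div_assoc, div_le_one hn0]; exact hhnR) hk₀ htail' (by
      push_cast
      have : ((⌈24 * w * l⌉₊ : ℝ) + 1) * (4 * (32 * y)) ≤
          (24 * w * l + 2) * (4 * (32 * y)) :=
        mul_le_mul_of_nonneg_right (by linarith) (by positivity)
      linarith)
  have hlw : l ≤ w * l := le_mul_of_one_le_left (by linarith) hw1
  have hww : w ≤ w * l := le_mul_of_one_le_right (by linarith) hl1
  have hq0 : 0 ≤ n * (p.p01 + p.p10) := by positivity
  have hmain := one_sub_le_correlatedER_real p (T := T) (K := ⌈24 * w * l⌉₊) (S := ⌈24 * w⌉₊)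
    (η := 4 * (32 * y)) (s := 4 * w) (s' := 4 * w * l) (L := 2 * Real.log h) (L' := 2 * l)
    (by omega) (by omega) (by omega) (by positivity) (by linarith) h00 hT hT1 hTK hmass
    (by positivity) (by positivity) (by positivity) (by positivity)
    (by linarith [Nat.le_ceil (24 * w)])
    (by linarith [Nat.le_ceil (24 * w * l)])
    (by linarith) (by rw [mul_pow, hw2]; linarith) (by linarith)
    (by
      have h1 : n * (p.p01 + p.p10) ≤ M := (le_mul_of_one_le_right hq0 hlh).trans hM2
      have h2 : n * (p.p01 + p.p10) * l ≤ M * l :=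
        mul_le_mul_of_nonneg_right h1 (by linarith)
      have h3 : M * l ≤ M * l * l := le_mul_of_one_le_right (by positivity) hl1
      rw [mul_pow, mul_pow, hw2]
      linarith)
    f hf
  refine le_trans ?_ hmain
  have hexp : ∀ t : ℝ, 0 < t → t * Real.exp (-(2 * Real.log t)) = 1 / t := by
    intro t ht
    rw [show -(2 * Real.log t) = -Real.log t + -Real.log t by ring, Real.exp_add, Real.exp_neg,
      Real.exp_log ht]
    field_simp
  rw [hexp h (by linarith), hexp n hn0]
  have h1 : 64 * (h : ℝ) ^ 2 * (⌈24 * w⌉₊ + 1) * (4 * (32 * y)) ≤ 212992 * ε := by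
    calc 64 * (h : ℝ) ^ 2 * (⌈24 * w⌉₊ + 1) * (4 * (32 * y))
        ≤ 64 * (h : ℝ) ^ 2 * (26 * w) * (4 * (32 * y)) := by gcongr; linarith
      _ = 212992 * (w * h ^ 2 * y) := by ring
      _ ≤ 212992 * ε := by gcongr
  have h2 : (36 : ℝ) / h = 4 / h + 32 * (1 / h) := by ring
  have h3 : (4 : ℝ) / n = 4 * (1 / n) := by ring
  rw [h2, h3]
  linarith

theorem theorem3 (p : ℕ → EdgeLaw) (h : ℕ → ℕ)
    (hp00 : Tendsto (fun n => (p n).p00) atTop (𝓝 1))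
    (hhn : ∀ n, h n ≤ n)
    (hh_lower : (fun n : ℕ => Real.log n) =o[atTop] fun n => (h n : ℝ))
    (hh_upper : (fun n => (h n : ℝ)) =o[atTop] fun n : ℕ => (n : ℝ))
    (hcond : (fun n : ℕ => max (Real.log (h n) ^ 2)
        (n * ((p n).p01 + (p n).p10) * Real.log (h n))) =o[atTop]
      fun n : ℕ => n * (p n).p11 / ((h n : ℝ) ^ 4 * Real.log n) * ((p n).p11 / (p n).p1s))
    (f : (n : ℕ) → SimpleGraph (Fin n) → (Fin (h n) → Fin n))
    (hf : ∀ n, IsHighDegreeSorting (f n)) :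
    Tendsto (fun n => (correlatedER n (p n)).real
        {G | f n G.1 = f n G.2 ∧ DegreeSeparated (h n) G.1 ∧ DegreeSeparated (h n) G.2})
      atTop (𝓝 1) := by
  have hlogn : Tendsto (fun n : ℕ => Real.log n) atTop atTop :=
    Real.tendsto_log_atTop.comp tendsto_natCast_atTop_atTop
  have hle : ∀ᶠ n : ℕ in atTop, Real.log n ≤ h n := by
    filter_upwards [hh_lower.bound one_pos, hlogn.eventually_ge_atTop 0] with n h1 h2
    simpa [abs_of_nonneg h2] using h1
  have hhtop : Tendsto (fun n => (h n : ℝ)) atTop atTop := tendsto_atTop_mono' _ hle hlogn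
  have hhalf : ∀ᶠ n : ℕ in atTop, 2 * h n ≤ n := by
    filter_upwards [hh_upper.bound (show (0 : ℝ) < 1 / 2 by norm_num)] with n h1
    simp only [Real.norm_natCast] at h1
    have : (2 * h n : ℝ) ≤ n := by linarith
    exact_mod_cast this
  rw [tendsto_order]
  refine ⟨fun b hb => ?_, fun b hb => Eventually.of_forall fun n =>
    measureReal_le_one.trans_lt hb⟩
  obtain ⟨ε, hε0, hε1, hεb⟩ : ∃ ε : ℝ, 0 < ε ∧ ε ≤ 1 / 10000 ∧ 440000 * ε ≤ 1 - b :=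
    ⟨min (1 / 10000) ((1 - b) / 440000), by
      refine lt_min (by norm_num) (div_pos (by linarith) (by norm_num)), min_le_left _ _, by
      have := min_le_right (1 / 10000 : ℝ) ((1 - b) / 440000)
      linarith⟩
  have hlim : Tendsto (fun n : ℕ => 36 / (h n : ℝ) + 4 / (n : ℝ)) atTop (𝓝 (0 + 0)) :=
    (hhtop.const_div_atTop 36).add (tendsto_natCast_atTop_atTop.const_div_atTop 4)
  rw [add_zero] at hlim
  filter_upwards [hle, hhalf, hhtop.eventually_ge_atTop 3, hlogn.eventually_ge_atTop 1,
    hp00.eventually (eventually_ge_nhds (show (3 / 4 : ℝ) < 1 by norm_num)),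
    hcond.bound (show 0 < ε ^ 2 by positivity),
    hlim.eventually_lt_const (show 0 < (1 - b) / 4 by linarith)]
    with n h1 h2 h3 h4 h5 h6 h7
  have h11 := (p n).p11_nonneg
  have h10 := (p n).p10_nonneg
  have hpos : 0 < (h n : ℝ) ^ 4 * Real.log n := by positivity
  have hratio : (p n).p11 / (p n).p1s ≤ 1 :=
    div_le_one_of_le₀ (by unfold EdgeLaw.p1s; linarith) (by unfold EdgeLaw.p1s; linarith)
  have hratio0 : 0 ≤ (p n).p11 / (p n).p1s :=
    div_nonneg h11 (by unfold EdgeLaw.p1s; linarith)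
  have hM : max (Real.log (h n) ^ 2) (n * ((p n).p01 + (p n).p10) * Real.log (h n)) *
      ((h n : ℝ) ^ 4 * Real.log n) ≤ ε ^ 2 * (n * (p n).p11) := by
    have h8 : 0 ≤ n * (p n).p11 / ((h n : ℝ) ^ 4 * Real.log n) := by positivity
    rw [Real.norm_eq_abs, Real.norm_eq_abs, abs_of_nonneg (mul_nonneg h8 hratio0)] at h6
    have h9 := (le_abs_self _).trans h6
    have h10 := h9.trans (mul_le_mul_of_nonneg_left (mul_le_of_le_one_right h8 hratio)
      (sq_nonneg ε))
    rwa [← mul_div_assoc, le_div_iff₀ hpos] at h10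
  have hfin := one_sub_le_correlatedER_real_of_le (p n) (by exact_mod_cast h3) h2 hε0 hε1 h5 h1
    (le_max_left _ _) (le_max_right _ _) hM (f n) (hf n)
  refine lt_of_lt_of_le ?_ hfin
  linarith
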